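/- Let $K$ be a field of characteristic zero and $\varepsilon\in\{1,-1\}$. Let $A1_\varepsilon$ be the $\mathbb{Z}_2\times\mathbb{Z}_2$-graded color Lie algebra over $K$, with commuting factor $(-1)^{\alpha\cdot\beta}$, $\alpha\cdot\beta=\alpha_1\beta_2-\alpha_2\beta_1$, and with basis $H=Q_0,Q_1,Q_2,Q_3$ of degrees $(0,0),(1,0),(0,1),(1,1)$, whose brackets are $$[H,Q_k]=0,\qquad \{Q_1,Q_2\}=Q_3,\qquad \{Q_2,Q_3\}=\varepsilon Q_1,\qquad \{Q_3,Q_1\}=Q_2$$ (and $[Q_k,Q_k]=0$). Let $U$ be its universal enveloping algebra, the quotient of the tensor algebra by the relations $X\otimes Y=S(X,Y)+[\![X,Y]\!]$, where $S(X,Y)=(-1)^{\alpha\cdot\beta}\,Y\otimes X$ for homogeneous $X,Y$ of degrees $\alpha,\beta$. Let $Z(U)$ be the center of $U$, let $C=\mathrm{diag}(1,\varepsilon,1,1)$ be the inverse of the invariant bilinear form, let $c=H^2+\varepsilon Q_1^2+Q_2^2+Q_3^2$ be the Casimir element, and put $y=c-H^2$; both $c$ and $y$ lie in $Z(U)$.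 For $n\ge 0$ let $\mathcal{A}_n$ (resp. $\bar{\mathcal{A}}_n$) be the $K$-vector space spanned by the chord diagrams with $n$ chords on an oriented circle, modulo the four-term relations (resp. the four-term relations and the one-term relations, by which a diagram with an isolated chord is zero), and let $\pi:\mathcal{A}_n\to\bar{\mathcal{A}}_n$ be the projection. Let $s:\mathcal{A}_n\to\mathcal{A}_{n-1}$ send a diagram to the sum of all diagrams obtained from it by deleting one chord (with $s=0$ on $\mathcal{A}_0$), let $\theta:\mathcal{A}_n\to\mathcal{A}_{n+1}$ be the connected sum with the diagram with a single chord, and let $$\varphi=\sum_{k=0}^{n}\frac{(-1)^k}{k!}\,\theta^k s^k:\mathcal{A}_n\to\mathcal{A}_n$$ be the deframing operator. The universal $A1_\varepsilon$ weight system for framed knots is the linear map $w:\mathcal{A}_n\to Z(U)$ computed on a chord diagram $D$ as follows: cut the circle at a point that is not an end of a chord, label each chord by one of the four basis vectors, multiply the product of the labels, taken in the order of the $2n$ chord ends along the line, by the entry $C^{aa}$ for each chord with label $Q_a$ and by the commuting factor of the two labels for each pair of crossing chords, and sum over all labellings. The universal $A1_\varepsilon$ weight system for unframed knots is the linear map $\bar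 w:\bar{\mathcal{A}}_n\to Z(U)$ with $\bar w\circ\pi=w\circ\varphi$. **Theorem.** For every $n$ the maps $w$ (independently of the cut) and $\bar w$ are well defined, the elements $c$ and $y$ are algebraically independent over $K$, and $w(D)$ is a polynomial in $c$ and $y$ for every $D\in\mathcal{A}_n$. If $P_D(c,y)$ is this polynomial, $w(D)=P_D(c,y)$, then $$\bar w(\pi(D))=P_D(0,y),$$ that is, $\bar w(D)=w(D)|_{c=0}$, where $y$ is kept fixed. -/

import Mathlib

open scoped BigOperators

namespace A1Weight

noncomputable section

/-! ### Chord diagrams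

A chord diagram with `n` chords is a circle with `2 * n` distinct marked points that are joined in
pairs. Cutting the circle and reading off, in the order of the orientation, the names of the chords
gives a word in which each of the `n` names occurs exactly twice. -/

/-- The word `l` uses each of the `n` chord names exactly twice. -/
def IsGauss {n : ℕ} (l : List (Fin n)) : Prop := ∀ i, l.count i = 2

/-- A chord diagram that has been cut open and whose chords are named by `Fin n`. -/
structure GaussWord (n : ℕ) where
  letters : List (Fin n)
  gauss : IsGauss letters

/-- Two words describe the same chord diagram on the circle when they differ by a renaming of the
chords and by the choice of the cut. -/
def GaussWord.SameDiagram {n : ℕ} (d d' : GaussWord n) : Prop :=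
  ∃ σ : Equiv.Perm (Fin n), d.letters.map σ ~r d'.letters

theorem GaussWord.sameDiagram_equivalence (n : ℕ) :
    Equivalence (GaussWord.SameDiagram (n := n)) where
  refl d := ⟨1, by simp [List.IsRotated.refl]⟩
  symm := by
    rintro d d' ⟨σ, h⟩
    refine ⟨σ⁻¹, ?_⟩
    have := (h.map (σ⁻¹ : Equiv.Perm (Fin n))).symm
    simpa [List.map_map, Function.comp_def] using this
  trans := by
    rintro d d' d'' ⟨σ, h⟩ ⟨τ, h'⟩
    refine ⟨τ * σ, ?_⟩
    have := (h.map τ).trans h'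
    simpa [List.map_map, Function.comp_def] using this

instance GaussWord.setoid (n : ℕ) : Setoid (GaussWord n) :=
  ⟨GaussWord.SameDiagram, GaussWord.sameDiagram_equivalence n⟩

/-- Chord diagrams with `n` chords on an oriented circle. -/
def ChordDiagram (n : ℕ) : Type := Quotient (GaussWord.setoid n)

/-- The chord diagram that is obtained by closing up a word. -/
def GaussWord.close {n : ℕ} (d : GaussWord n) : ChordDiagram n := Quotient.mk _ d

section Spaces

variable (K : Type*) [Field K]

/-- The basis vector, in the space of formal combinations of chord diagrams, of the diagram of a
word. -/
def vec {n : ℕ} (l : List (Fin n)) (h : IsGauss l) : ChordDiagram n →₀ K :=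
  Finsupp.single (GaussWord.close ⟨l, h⟩) 1

/-- The four-term relations: `a` and `b` are chords, one end of `a` is fixed, and the other end
passes the first or the second end of `b`. -/
def fourTerm (n : ℕ) : Set (ChordDiagram n →₀ K) :=
  {x | ∃ (a b : Fin n) (U V W : List (Fin n))
      (h₁ : IsGauss ([a] ++ U ++ [a, b] ++ V ++ [b] ++ W))
      (h₂ : IsGauss ([a] ++ U ++ [b, a] ++ V ++ [b] ++ W))
      (h₃ : IsGauss ([a] ++ U ++ [b] ++ V ++ [a, b] ++ W))
      (h₄ : IsGauss ([a] ++ U ++ [b] ++ V ++ [b, a] ++ W)),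
      x = vec K _ h₁ - vec K _ h₂ + vec K _ h₃ - vec K _ h₄}

/-- The one-term relations: a diagram with an isolated chord, that is a chord whose two ends are
neighbours on the circle, is zero. -/
def oneTerm (n : ℕ) : Set (ChordDiagram n →₀ K) :=
  {x | ∃ (a : Fin n) (U : List (Fin n)) (h : IsGauss ([a, a] ++ U)), x = vec K _ h}

/-- The space `𝒜ₙ` of chord diagrams with `n` chords modulo the four-term relations. -/
abbrev FramedSpace (n : ℕ) : Type _ :=
  (ChordDiagram n →₀ K) ⧸ Submodule.span K (fourTerm K n)

/-- The space `𝒜̄ₙ` of chord diagrams with `n` chords modulo the four-term and the one-term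
relations. -/
abbrev UnframedSpace (n : ℕ) : Type _ :=
  (ChordDiagram n →₀ K) ⧸ Submodule.span K (fourTerm K n ∪ oneTerm K n)

/-- The canonical projection `𝒜ₙ → 𝒜̄ₙ`. -/
def forgetFraming (n : ℕ) : FramedSpace K n →ₗ[K] UnframedSpace K n :=
  Submodule.factor (Submodule.span_mono Set.subset_union_left)

/-- The class in `𝒜ₙ` of the chord diagram of a word. -/
def cls {n : ℕ} (d : GaussWord n) : FramedSpace K n :=
  Submodule.Quotient.mk (Finsupp.single d.close 1)

end Spaces

/-! ### The deframing operator -/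

theorem count_delete {n : ℕ} (a : Fin (n + 1)) (i : Fin n) (l : List (Fin (n + 1))) :
    (l.filterMap (finSuccEquiv' a)).count i = l.count (a.succAbove i) := by
  induction l with
  | nil => simp
  | cons x l ih =>
    rcases Fin.eq_self_or_eq_succAbove a x with rfl | ⟨j, rfl⟩
    · simp [ih, (Fin.succAbove_ne x i).symm]
    · simp [ih, List.count_cons]

/-- Delete the chord `a` (and rename the others). -/
def GaussWord.delete {n : ℕ} (d : GaussWord (n + 1)) (a : Fin (n + 1)) : GaussWord n where
  letters := d.letters.filterMap (finSuccEquiv' a)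
  gauss i := by rw [count_delete]; exact d.gauss _

theorem isGauss_addIsolated {n : ℕ} {l : List (Fin n)} (h : IsGauss l) :
    IsGauss (l.map Fin.castSucc ++ [Fin.last n, Fin.last n]) := by
  intro i
  refine Fin.lastCases ?_ (fun j => ?_) i
  · have : (l.map Fin.castSucc).count (Fin.last n) = 0 := by
      rw [List.count_eq_zero]; simp
    simp [this]
  · rw [List.count_append, List.count_map_of_injective _ _ (Fin.castSucc_injective n), h j]
    simp [(Fin.castSucc_ne_last j).symm]

/-- The connected sum with the diagram that has a single chord: a new chord, with neighbouring
ends, is added at the cut. -/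
def GaussWord.addIsolated {n : ℕ} (d : GaussWord n) : GaussWord (n + 1) where
  letters := d.letters.map Fin.castSucc ++ [Fin.last n, Fin.last n]
  gauss := isGauss_addIsolated d.gauss

theorem isRotated_filterMap {α β : Type*} (f : α → Option β) {l l' : List α} (h : l ~r l') :
    l.filterMap f ~r l'.filterMap f := by
  obtain ⟨k, rfl⟩ := h
  induction k generalizing l with
  | zero => simp [List.IsRotated.refl]
  | succ k ih =>
    cases l with
    | nil => simp [List.IsRotated.refl]
    | cons x l =>
      rw [List.rotate_cons_succ]
      refine List.IsRotated.trans ?_ ih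
      rw [List.filterMap_append]
      cases hx : f x with
      | none => simp [hx, List.IsRotated.refl]
      | some y => simpa [hx] using List.IsRotated.cons_append_singleton

theorem GaussWord.delete_close_eq {n : ℕ} {d d' : GaussWord (n + 1)}
    (σ : Equiv.Perm (Fin (n + 1))) (h : d.letters.map σ ~r d'.letters) (a : Fin (n + 1)) :
    (d.delete a).close = (d'.delete (σ a)).close := by
  apply Quotient.sound
  let e : Option (Fin n) ≃ Option (Fin n) :=
    (finSuccEquiv' a).symm.trans (σ.trans (finSuccEquiv' (σ a)))
  have he : e none = none := by simp [e]
  refine ⟨e.removeNone, ?_⟩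
  have h2 := isRotated_filterMap (finSuccEquiv' (σ a)) h
  have h3 : ∀ l : List (Fin (n + 1)), (l.filterMap (finSuccEquiv' a)).map e.removeNone =
      (l.map σ).filterMap (finSuccEquiv' (σ a)) := by
    intro l
    induction l with
    | nil => simp
    | cons x l ih =>
      rcases Fin.eq_self_or_eq_succAbove a x with rfl | ⟨j, rfl⟩
      · simpa using ih
      · have hj : e (some j) = some (e.removeNone j) := by
          rw [Equiv.removeNone_some]
          by_contra hc
          have : e (some j) = none := by
            cases hh : e (some j) with
            | none => rfl
            | some z => exact absurd ⟨z, hh⟩ hc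
          exact absurd (e.injective (this.trans he.symm)) (by simp)
        have hj' : finSuccEquiv' (σ a) (σ (a.succAbove j)) = some (e.removeNone j) := by
          rw [← hj]; simp [e]
        simp [hj', ih]
  show (d.letters.filterMap (finSuccEquiv' a)).map e.removeNone ~r _
  rw [h3]
  exact h2

section Operators

variable (K : Type*) [Field K]

theorem cls_congr {n : ℕ} {d d' : GaussWord n} (h : d.letters ~r d'.letters) :
    cls K d = cls K d' := by
  have : d.close = d'.close := Quotient.sound ⟨1, by simpa using h⟩
  simp only [cls, this]

theorem cls_fourTerm {n : ℕ} (a b : Fin n) (U V W : List (Fin n))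
    {d₁ d₂ d₃ d₄ : GaussWord n}
    (h₁ : d₁.letters = [a] ++ U ++ [a, b] ++ V ++ [b] ++ W)
    (h₂ : d₂.letters = [a] ++ U ++ [b, a] ++ V ++ [b] ++ W)
    (h₃ : d₃.letters = [a] ++ U ++ [b] ++ V ++ [a, b] ++ W)
    (h₄ : d₄.letters = [a] ++ U ++ [b] ++ V ++ [b, a] ++ W) :
    cls K d₁ - cls K d₂ + cls K d₃ - cls K d₄ = 0 := by
  obtain ⟨l₁, g₁⟩ := d₁
  obtain ⟨l₂, g₂⟩ := d₂
  obtain ⟨l₃, g₃⟩ := d₃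
  obtain ⟨l₄, g₄⟩ := d₄
  simp only at h₁ h₂ h₃ h₄
  subst h₁ h₂ h₃ h₄
  refine (Submodule.Quotient.mk_eq_zero _).2 (Submodule.subset_span ?_)
  exact ⟨a, b, U, V, W, g₁, g₂, g₃, g₄, rfl⟩

/-- The sum of all diagrams that are obtained from a given one by deleting one chord. -/
def deleteSum {n : ℕ} : ChordDiagram (n + 1) → FramedSpace K n :=
  Quotient.lift (fun d => ∑ a, cls K (d.delete a)) (by
    rintro d d' ⟨σ, h⟩
    refine Fintype.sum_equiv σ _ _ fun a => ?_
    simp only [cls, GaussWord.delete_close_eq σ h a])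

theorem deleteSum_fourTerm {n : ℕ} :
    Submodule.span K (fourTerm K (n + 1)) ≤
      LinearMap.ker (Finsupp.linearCombination K (deleteSum K (n := n))) := by
  rw [Submodule.span_le]
  rintro _ ⟨a, b, U, V, W, h₁, h₂, h₃, h₄, rfl⟩
  have key : ∀ (l : List (Fin (n + 1))) (h : IsGauss l),
      Finsupp.linearCombination K (deleteSum K (n := n)) (vec K l h) =
        ∑ x, cls K (GaussWord.delete ⟨l, h⟩ x) := by
    intro l h
    simp only [vec, Finsupp.linearCombination_single, one_smul]
    rfl
  simp only [SetLike.mem_coe, LinearMap.mem_ker, map_sub, map_add, key]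
  rw [← Finset.sum_sub_distrib, ← Finset.sum_add_distrib, ← Finset.sum_sub_distrib]
  refine Finset.sum_eq_zero fun x _ => ?_
  by_cases hab : a = b
  · subst hab
    have := h₁ a
    simp only [List.count_append, List.count_cons, List.count_nil, beq_self_eq_true, if_true]
      at this
    omega
  rcases Fin.eq_self_or_eq_succAbove x a with rfl | ⟨a', rfl⟩
  · have e₁ : cls K (GaussWord.delete ⟨_, h₁⟩ a) = cls K (GaussWord.delete ⟨_, h₂⟩ a) :=
      cls_congr K (by simp [GaussWord.delete, List.filterMap_append, List.filterMap_cons,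
        List.IsRotated.refl])
    have e₂ : cls K (GaussWord.delete ⟨_, h₃⟩ a) = cls K (GaussWord.delete ⟨_, h₄⟩ a) :=
      cls_congr K (by simp [GaussWord.delete, List.filterMap_append, List.filterMap_cons,
        List.IsRotated.refl])
    rw [e₁, e₂]; abel
  · rcases Fin.eq_self_or_eq_succAbove x b with rfl | ⟨b', rfl⟩
    · have e₁ : cls K (GaussWord.delete ⟨_, h₁⟩ b) = cls K (GaussWord.delete ⟨_, h₂⟩ b) :=
        cls_congr K (by simp [GaussWord.delete, List.filterMap_append,
          List.IsRotated.refl])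
      have e₂ : cls K (GaussWord.delete ⟨_, h₃⟩ b) = cls K (GaussWord.delete ⟨_, h₄⟩ b) :=
        cls_congr K (by simp [GaussWord.delete, List.filterMap_append,
          List.IsRotated.refl])
      rw [e₁, e₂]; abel
    · refine cls_fourTerm K a' b' (U.filterMap (finSuccEquiv' x)) (V.filterMap (finSuccEquiv' x))
        (W.filterMap (finSuccEquiv' x)) ?_ ?_ ?_ ?_ <;>
      simp [GaussWord.delete, List.filterMap_append]

/-- The linear map `s : 𝒜ₙ₊₁ → 𝒜ₙ` with `s(D) = ∑ₐ (D - a)`, the sum over all chords of `D`. -/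
def sMap (n : ℕ) : FramedSpace K (n + 1) →ₗ[K] FramedSpace K n :=
  Submodule.liftQ _ (Finsupp.linearCombination K (deleteSum K (n := n))) (deleteSum_fourTerm K)

theorem cls_addIsolated_rotate {n : ℕ} {x : Fin n} {l : List (Fin n)} {d d' : GaussWord n}
    (h : d.letters = x :: l) (h' : d'.letters = l ++ [x]) :
    cls K d.addIsolated = cls K d'.addIsolated := by
  have hx : x ∈ l := by
    have := d.gauss x
    rw [h, List.count_cons_self] at this
    exact List.count_pos_iff.1 (by omega)
  obtain ⟨P, Q, rfl⟩ := List.append_of_mem hx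
  set X := x.castSucc with hX
  set N := Fin.last n with hN
  set P' := P.map Fin.castSucc with hP
  set Q' := Q.map Fin.castSucc with hQ
  have gd := d.addIsolated.gauss
  have r : d.addIsolated.letters = X :: (P' ++ X :: Q') ++ [N, N] := by
    simp [GaussWord.addIsolated, h, hX, hN, hP, hQ]
  have r' : d'.addIsolated.letters = (P' ++ X :: Q') ++ [X] ++ [N, N] := by
    simp [GaussWord.addIsolated, h', hX, hN, hP, hQ]
  have perm_gauss : ∀ l : List (Fin (n + 1)), l.Perm d.addIsolated.letters → IsGauss l :=
    fun l hl i => by rw [hl.count_eq]; exact gd i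
  have g₁ : IsGauss ([X] ++ Q' ++ [X, N] ++ [] ++ [N] ++ P') := by
    apply perm_gauss; rw [r, List.perm_iff_count]; intro i; simp [List.count_cons]; omega
  have g₂ : IsGauss ([X] ++ Q' ++ [N, X] ++ [] ++ [N] ++ P') := by
    apply perm_gauss; rw [r, List.perm_iff_count]; intro i; simp [List.count_cons]; omega
  have g₄ : IsGauss ([X] ++ Q' ++ [N] ++ [] ++ [N, X] ++ P') := by
    apply perm_gauss; rw [r, List.perm_iff_count]; intro i; simp [List.count_cons]; omega
  have e₁ : cls K d'.addIsolated = cls K ⟨_, g₁⟩ := cls_congr K (by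
    rw [r']
    have : (P' ++ X :: Q') ++ [X] ++ [N, N] = P' ++ ([X] ++ Q' ++ [X, N] ++ [] ++ [N]) := by simp
    rw [this]
    exact List.isRotated_append)
  have e₄ : cls K d.addIsolated = cls K ⟨_, g₄⟩ := cls_congr K (by
    rw [r]
    have : X :: (P' ++ X :: Q') ++ [N, N] = (X :: P') ++ ([X] ++ Q' ++ [N, N]) := by simp
    rw [this]
    have h2 : [X] ++ Q' ++ [N] ++ [] ++ [N, X] ++ P' = ([X] ++ Q' ++ [N, N]) ++ (X :: P') := by
      simp
    simp only [h2]
    exact List.isRotated_append)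
  have := cls_fourTerm K X N Q' [] P' (d₁ := ⟨_, g₁⟩) (d₂ := ⟨_, g₂⟩) (d₃ := ⟨_, g₂⟩)
    (d₄ := ⟨_, g₄⟩) rfl rfl (by simp) rfl
  rw [e₁, e₄]
  rw [sub_add_cancel, sub_eq_zero] at this
  exact this.symm

theorem cls_addIsolated_congr {n : ℕ} (k : ℕ) : ∀ {d d' : GaussWord n},
    d.letters.rotate k = d'.letters → cls K d.addIsolated = cls K d'.addIsolated := by
  induction k with
  | zero =>
    rintro ⟨l, h⟩ ⟨l', h'⟩ e
    simp only [List.rotate_zero] at e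
    subst e; rfl
  | succ k ih =>
    rintro ⟨l, h⟩ d' e
    cases l with
    | nil => exact ih (by simpa using e)
    | cons x l =>
      have g : IsGauss (l ++ [x]) := fun i => by
        rw [← h i]; exact (List.perm_append_singleton x l).count_eq i
      rw [cls_addIsolated_rotate K (d := ⟨x :: l, h⟩) (d' := ⟨l ++ [x], g⟩) rfl rfl]
      refine ih ?_
      simpa using e

/-- The connected sum of a chord diagram with the diagram that has a single chord. -/
def connectedSumChord {n : ℕ} : ChordDiagram n → FramedSpace K (n + 1) :=
  Quotient.lift (fun d => cls K d.addIsolated) (by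
    rintro d d' ⟨σ, k, hk⟩
    have g : IsGauss (d.letters.map σ) := fun i => by
      obtain ⟨j, rfl⟩ := σ.surjective i
      rw [List.count_map_of_injective _ _ σ.injective]
      exact d.gauss j
    refine Eq.trans ?_ (cls_addIsolated_congr K k (d := ⟨d.letters.map σ, g⟩) hk)
    have : d.addIsolated.close = (GaussWord.addIsolated ⟨d.letters.map σ, g⟩).close := by
      refine Quotient.sound ⟨finSuccEquivLast.trans ((Equiv.optionCongr σ).trans
        finSuccEquivLast.symm), ?_⟩
      have : ∀ l l' : List (Fin (n + 1)), l = l' → l ~r l' := by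
        rintro l _ rfl; exact List.IsRotated.refl l
      apply this
      simp [GaussWord.addIsolated, Function.comp_def]
    simp only [cls, this])

theorem connectedSumChord_fourTerm {n : ℕ} :
    Submodule.span K (fourTerm K n) ≤
      LinearMap.ker (Finsupp.linearCombination K (connectedSumChord K (n := n))) := by
  rw [Submodule.span_le]
  rintro _ ⟨a, b, U, V, W, h₁, h₂, h₃, h₄, rfl⟩
  have key : ∀ (l : List (Fin n)) (h : IsGauss l),
      Finsupp.linearCombination K (connectedSumChord K (n := n)) (vec K l h) =
        cls K (GaussWord.addIsolated ⟨l, h⟩) := by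
    intro l h
    simp only [vec, Finsupp.linearCombination_single, one_smul]
    rfl
  simp only [SetLike.mem_coe, LinearMap.mem_ker, map_sub, map_add, key]
  refine cls_fourTerm K a.castSucc b.castSucc (U.map Fin.castSucc) (V.map Fin.castSucc)
    (W.map Fin.castSucc ++ [Fin.last n, Fin.last n]) ?_ ?_ ?_ ?_ <;>
  simp [GaussWord.addIsolated]

/-- The linear map `θ : 𝒜ₙ → 𝒜ₙ₊₁`, connected sum with the diagram that has a single chord. -/
def thetaMap (n : ℕ) : FramedSpace K n →ₗ[K] FramedSpace K (n + 1) :=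
  Submodule.liftQ _ (Finsupp.linearCombination K (connectedSumChord K (n := n)))
    (connectedSumChord_fourTerm K)

/-- The map `θᵏ ∘ sᵏ : 𝒜ₙ → 𝒜ₙ`; as `s` is zero on `𝒜₀`, it is zero for `k > n`. -/
def thetaPowSPow : ℕ → ∀ n : ℕ, FramedSpace K n →ₗ[K] FramedSpace K n
  | 0, _ => LinearMap.id
  | _ + 1, 0 => 0
  | k + 1, n + 1 => thetaMap K n ∘ₗ thetaPowSPow k n ∘ₗ sMap K n

/-- The deframing operator `φ = ∑_{k = 0}^{n} (-1)ᵏ / k! θᵏ sᵏ` on `𝒜ₙ`. -/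
def deframe (n : ℕ) : FramedSpace K n →ₗ[K] FramedSpace K n :=
  ∑ k ∈ Finset.range (n + 1), ((-1 : K) ^ k / (k.factorial : K)) • thetaPowSPow K k n

end Operators

/-! ### The color Lie algebra `A1_ε` and its universal enveloping algebra -/

/-- The grading group. -/
abbrev Grading : Type := ZMod 2 × ZMod 2

section Algebra

variable {K : Type*} [Field K]

/-- The commuting factor `(-1) ^ (α₁ β₂ - α₂ β₁)` of `ℤ₂ × ℤ₂`-graded Lie algebras. -/
def commFactor (K : Type*) [Field K] (α β : Grading) : K :=
  if α.1 * β.2 - α.2 * β.1 = 0 then 1 else -1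

/-- The underlying vector space of `A1_ε`. It has a basis with one vector of each degree: the
vectors `H`, `Q₁`, `Q₂`, `Q₃` of degrees `(0,0)`, `(1,0)`, `(0,1)`, `(1,1)`. -/
abbrev A1 (K : Type*) : Type _ := Grading → K

/-- The homogeneous basis vector of degree `α`. -/
def basisVec (K : Type*) [Field K] (α : Grading) : A1 K := Pi.single α 1

/-- The structure constants of `A1_ε`: the bracket of the basis vectors of degrees `α` and `β` is
this multiple of the basis vector of degree `α + β`. So `H` is central, a basis vector has zero
bracket with itself, and `{Q₁, Q₂} = Q₃`, `{Q₂, Q₃} = ε Q₁`, `{Q₃, Q₁} = Q₂`. -/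
def structConst (ε : K) (α β : Grading) : K :=
  if α = 0 ∨ β = 0 ∨ α = β then 0 else if α + β = (1, 0) then ε else 1

/-- The graded Lie bracket of `A1_ε`. -/
def bracket (ε : K) (X Y : A1 K) : A1 K :=
  ∑ α, ∑ β, (structConst ε α β * X α * Y β) • basisVec K (α + β)

/-- The element `S(X, Y)` of the tensor algebra, where `S` is the bilinear map with
`S(X, Y) = commFactor α β • Y ⊗ X` for `X` and `Y` homogeneous of degrees `α` and `β`. -/
def braid (X Y : A1 K) : TensorAlgebra K (A1 K) :=
  ∑ α, ∑ β, (commFactor K α β * X α * Y β) •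
    (TensorAlgebra.ι K (basisVec K β) * TensorAlgebra.ι K (basisVec K α))

/-- The relations `X ⊗ Y = S(X, Y) + ⟦X, Y⟧` of the universal enveloping algebra. -/
inductive EnvelopingRel (ε : K) : TensorAlgebra K (A1 K) → TensorAlgebra K (A1 K) → Prop
  | of (X Y : A1 K) : EnvelopingRel ε (TensorAlgebra.ι K X * TensorAlgebra.ι K Y)
      (braid X Y + TensorAlgebra.ι K (bracket ε X Y))

/-- The universal enveloping algebra of `A1_ε`. -/
def Enveloping (ε : K) : Type _ := RingQuot (EnvelopingRel ε)

instance (ε : K) : Ring (Enveloping ε) := inferInstanceAs (Ring (RingQuot (EnvelopingRel ε)))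

instance (ε : K) : Algebra K (Enveloping ε) :=
  inferInstanceAs (Algebra K (RingQuot (EnvelopingRel ε)))

/-- The quotient map from the tensor algebra to the universal enveloping algebra. -/
def Enveloping.mk (ε : K) : TensorAlgebra K (A1 K) →ₐ[K] Enveloping ε :=
  RingQuot.mkAlgHom K (EnvelopingRel ε)

/-- The basis vector of degree `α`, as an element of the universal enveloping algebra. -/
def gen (ε : K) (α : Grading) : Enveloping ε :=
  Enveloping.mk ε (TensorAlgebra.ι K (basisVec K α))

/-- The diagonal entries of the inverse `C` of the invariant bilinear form `diag(1, ε, 1, 1)`; for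
`ε = ±1` the matrix is its own inverse. -/
def invForm (ε : K) (α : Grading) : K := if α = (1, 0) then ε else 1

theorem gen_mul_gen (ε : K) (α β : Grading) :
    gen ε α * gen ε β =
      commFactor K α β • (gen ε β * gen ε α) + structConst ε α β • gen ε (α + β) := by
  have h : Enveloping.mk ε _ = Enveloping.mk ε _ :=
    RingQuot.mkAlgHom_rel K (EnvelopingRel.of (ε := ε) (basisVec K α) (basisVec K β))
  have hb : bracket ε (basisVec K α) (basisVec K β) =
      structConst ε α β • basisVec K (α + β) := by
    rw [bracket, Finset.sum_eq_single α, Finset.sum_eq_single β] <;>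
      simp +contextual [basisVec, Pi.single_apply]
  have hs : braid (basisVec K α) (basisVec K β) = commFactor K α β •
      (TensorAlgebra.ι K (basisVec K β) * TensorAlgebra.ι K (basisVec K α)) := by
    rw [braid, Finset.sum_eq_single α, Finset.sum_eq_single β] <;>
      simp +contextual [basisVec, Pi.single_apply]
  rw [hb, hs] at h
  simpa [gen] using h

theorem mem_center_of_commute (ε : K) (z : Enveloping ε)
    (h : ∀ α, gen ε α * z = z * gen ε α) : z ∈ Subalgebra.center K (Enveloping ε) := by
  rw [Subalgebra.mem_center_iff]
  intro u
  obtain ⟨t, rfl⟩ : ∃ t, Enveloping.mk ε t = u :=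
    RingQuot.mkAlgHom_surjective K (EnvelopingRel ε) u
  induction t using TensorAlgebra.induction with
  | algebraMap r => simp only [AlgHom.commutes]; exact Algebra.commutes r z
  | ι X =>
    have : X = ∑ α, X α • basisVec K α := by
      funext β; simp [basisVec, Finset.sum_apply, Pi.single_apply]
    rw [this]
    simp only [map_sum, map_smul, Finset.sum_mul, Finset.mul_sum, smul_mul_assoc, mul_smul_comm]
    exact Finset.sum_congr rfl fun α _ => by rw [← gen, h α]
  | mul a b ha hb => rw [map_mul, mul_assoc, hb, ← mul_assoc, ha, mul_assoc]
  | add a b ha hb => rw [map_add, add_mul, mul_add, ha, hb]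

theorem gen_zero_mem_center (ε : K) : gen ε 0 ∈ Subalgebra.center K (Enveloping ε) :=
  mem_center_of_commute ε _ fun α => by simp [gen_mul_gen ε α 0, commFactor, structConst]

theorem gen_anticomm (ε : K) {α β γ : Grading} (r : K) (h : α.1 * β.2 - α.2 * β.1 ≠ 0)
    (hγ : α + β = γ) (hr : structConst ε α β = r) :
    gen ε α * gen ε β = -(gen ε β * gen ε α) + r • gen ε γ := by
  rw [gen_mul_gen, commFactor, if_neg h, hγ, hr, neg_smul, one_smul]

theorem structConst_of {ε : K} {α β : Grading} (h : ¬ (α = 0 ∨ β = 0 ∨ α = β)) :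
    structConst ε α β = if α + β = (1, 0) then ε else 1 := if_neg h

theorem commutator_sq {R : Type*} [Ring R] {P X Y : R} (h : P * X = -(X * P) + Y) :
    P * (X * X) = X * X * P + (Y * X - X * Y) := by
  have h' := sub_eq_zero.2 h
  rw [← sub_eq_zero]
  calc _ = (P * X - (-(X * P) + Y)) * X - X * (P * X - (-(X * P) + Y)) := by noncomm_ring
    _ = 0 := by rw [h']; simp

theorem casimir_mem_center (ε : K) :
    ∑ α, invForm ε α • (gen ε α * gen ε α) ∈ Subalgebra.center K (Enveloping ε) := by
  have hsum : ∑ α, invForm ε α • (gen ε α * gen ε α) =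
      gen ε 0 * gen ε 0 + ε • (gen ε (1, 0) * gen ε (1, 0)) +
        (gen ε (0, 1) * gen ε (0, 1) + gen ε (1, 1) * gen ε (1, 1)) := by
    have : (Finset.univ : Finset Grading) = {0, (1, 0), (0, 1), (1, 1)} := by decide
    rw [this, Finset.sum_insert (by decide), Finset.sum_insert (by decide),
      Finset.sum_insert (by decide), Finset.sum_singleton]
    simp only [invForm, if_pos, one_smul, if_neg (show ¬ ((0 : Grading) = (1, 0)) by decide),
      if_neg (show ¬ (((0, 1) : Grading) = (1, 0)) by decide),
      if_neg (show ¬ (((1, 1) : Grading) = (1, 0)) by decide), add_assoc]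
  have c0 : ∀ α, gen ε α * gen ε 0 = gen ε 0 * gen ε α := fun α => by
    simp [gen_mul_gen ε α 0, commFactor, structConst]
  have h12 := gen_anticomm ε (α := (1, 0)) (β := (0, 1)) (γ := (1, 1)) 1 (by decide) (by decide)
    (by rw [structConst_of (by decide), if_neg (by decide)])
  have h23 := gen_anticomm ε (α := (0, 1)) (β := (1, 1)) (γ := (1, 0)) ε (by decide) (by decide)
    (by rw [structConst_of (by decide), if_pos (by decide)])
  have h31 := gen_anticomm ε (α := (1, 1)) (β := (1, 0)) (γ := (0, 1)) 1 (by decide) (by decide)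
    (by rw [structConst_of (by decide), if_neg (by decide)])
  rw [one_smul] at h12 h31
  have h21 : gen ε (0, 1) * gen ε (1, 0) = -(gen ε (1, 0) * gen ε (0, 1)) + gen ε (1, 1) := by
    rw [h12]; simp
  have h32 : gen ε (1, 1) * gen ε (0, 1) = -(gen ε (0, 1) * gen ε (1, 1)) + ε • gen ε (1, 0) := by
    rw [h23]; simp
  have h13 : gen ε (1, 0) * gen ε (1, 1) = -(gen ε (1, 1) * gen ε (1, 0)) + gen ε (0, 1) := by
    rw [h31]; simp
  rw [hsum]
  refine mem_center_of_commute ε _ fun α => ?_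
  have hα : α = 0 ∨ α = (1, 0) ∨ α = (0, 1) ∨ α = (1, 1) := by revert α; decide
  have hH : gen ε α * (gen ε 0 * gen ε 0) = gen ε 0 * gen ε 0 * gen ε α := by
    rw [← mul_assoc, c0, mul_assoc, c0, mul_assoc]
  rw [mul_add, mul_add, mul_add, add_mul, add_mul, add_mul, hH, mul_smul_comm, smul_mul_assoc]
  rcases hα with rfl | rfl | rfl | rfl
  · simp only [mul_assoc, c0]
    simp only [← mul_assoc, c0]
  · rw [commutator_sq h12, commutator_sq h13, mul_assoc (gen ε (1, 0))]
    abel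
  · rw [commutator_sq h21, commutator_sq h23, mul_assoc (gen ε (0, 1))]
    simp only [smul_add, smul_sub, smul_mul_assoc, mul_smul_comm]
    abel
  · rw [commutator_sq h31, commutator_sq h32, mul_assoc (gen ε (1, 1))]
    simp only [smul_add, smul_sub, smul_mul_assoc, mul_smul_comm]
    abel

/-- The Casimir element `c = H² + ε Q₁² + Q₂² + Q₃²`, that is `∑ Cᵅᵝ X_α X_β`. -/
def casimir (ε : K) : Subalgebra.center K (Enveloping ε) :=
  ⟨∑ α, invForm ε α • (gen ε α * gen ε α), casimir_mem_center ε⟩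

/-- The central element `y = c - H²`. -/
def yElem (ε : K) : Subalgebra.center K (Enveloping ε) :=
  casimir ε - ⟨gen ε 0, gen_zero_mem_center ε⟩ ^ 2

/-! ### The weight of a chord diagram -/

/-- In the word `l` the chords `i` and `j` cross, and the first end of `i` comes first. -/
def Crosses {n : ℕ} (l : List (Fin n)) (i j : Fin n) : Prop := [i, j, i, j].Sublist l

instance {n : ℕ} (l : List (Fin n)) (i j : Fin n) : Decidable (Crosses l i j) :=
  inferInstanceAs (Decidable ([i, j, i, j].Sublist l))

/-- The weight of a chord diagram that has been cut open to a word: each chord is labelled by a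
basis vector (the same one at both ends, since the form is diagonal) and contributes an entry of
`C`, each crossing of two chords contributes an entry of `S`, which is the commuting factor of the
two labels, and the basis vectors are multiplied in the order in which the ends of the chords
appear; then one sums over all labellings. -/
def wordWeight (ε : K) {n : ℕ} (d : GaussWord n) : Enveloping ε :=
  ∑ f : Fin n → Grading,
    ((∏ i, invForm ε (f i)) *
        ∏ i, ∏ j, if Crosses d.letters i j then commFactor K (f i) (f j) else 1) •
      (d.letters.map fun i => gen ε (f i)).prod

end Algebra

end

end A1Weight

/-! The signs of the color algebra are removed by a twist. Each `Q_k` is multiplied by a 2×2 integer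
matrix with the same commutation signs, and `H` is replaced by `1`. The result represents an
ordinary Lie algebra whose Casimir element acts as `y` (`twistedGen_isTwistedRep`). Along a word the
matrices multiply to the crossing signs times their own squares (`wordProd_twist`). Hence the weight
of a diagram is the value of its word in an ordinary Lie algebra, in which the central label counts
with weight `t = H²` (`scalar_wordWeight`).

With `t` left free, the value is a polynomial in `t` and `y` (`IsTwistedRep.exists_polynomial`). A
central label merely deletes its chord. For the other labels the two ends of a chord are brought
together by commutators, and the cross-product identity `lieConst_contract` rewrites the error terms
as values of words with one chord less. Independence of the cut and the four-term relation follow,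
for every `t`, from the invariance of the form (`sum_lieForm_invariant`).

Deframing changes only `t`. Since the central label is represented by `1`, deleting a chord is the
same as giving it that label. Adding an isolated chord multiplies by `c`, so the alternating sum
over deleted chords turns the weight `H²` into `H² - c = -y` (`sum_pow_smul_deletedValue`,
`framedWeight_deframe`). An isolated chord contributes `t + y`, which vanishes there. So one
polynomial is evaluated at `t = c - y` before deframing and at `t = -y` after it, which is the
substitution `c = 0`.

Algebraic independence is seen in representations where `H` and `y` act by scalars with two free
parameters (`seqRep`). -/

namespace A1Weight

noncomputable section

/-! ### Sums over labellings -/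

section LabelSum

variable {R M L : Type*} [CommRing R] [Ring M] [Algebra R M]

/-- The product of the values of `X` at the labels, in the order of the word. -/
def wordProd {n : ℕ} (X : L → M) (f : Fin n → L) (l : List (Fin n)) : M :=
  (l.map fun i => X (f i)).prod

@[simp] theorem wordProd_nil {n : ℕ} (X : L → M) (f : Fin n → L) : wordProd X f [] = 1 := rfl

@[simp] theorem wordProd_cons {n : ℕ} (X : L → M) (f : Fin n → L) (a : Fin n)
    (l : List (Fin n)) : wordProd X f (a :: l) = X (f a) * wordProd X f l := by
  simp [wordProd]

@[simp] theorem wordProd_append {n : ℕ} (X : L → M) (f : Fin n → L) (l l' : List (Fin n)) :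
    wordProd X f (l ++ l') = wordProd X f l * wordProd X f l' := by
  simp [wordProd]

theorem wordProd_congr {n : ℕ} (X : L → M) {f f' : Fin n → L} {l : List (Fin n)}
    (h : ∀ i ∈ l, f i = f' i) : wordProd X f l = wordProd X f' l := by
  unfold wordProd
  congr 1
  exact List.map_congr_left fun i hi => by rw [h i hi]

theorem wordProd_update {n : ℕ} (X : L → M) (f : Fin n → L) {a : Fin n} (α : L)
    {l : List (Fin n)} (h : a ∉ l) :
    wordProd X (Function.update f a α) l = wordProd X f l :=
  wordProd_congr X fun i hi => Function.update_of_ne (fun e => h (by rwa [e] at hi)) _ _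

variable [Fintype L]

/-- The sum of a function of the labellings, with a weight for each chord. -/
def labelSum {n : ℕ} (B : Fin n → L → R) (G : (Fin n → L) → M) : M :=
  ∑ f : Fin n → L, (∏ i, B i (f i)) • G f

theorem labelSum_add {n : ℕ} (B : Fin n → L → R) (G G' : (Fin n → L) → M) :
    labelSum B (fun f => G f + G' f) = labelSum B G + labelSum B G' := by
  simp [labelSum, Finset.sum_add_distrib]

theorem labelSum_sub {n : ℕ} (B : Fin n → L → R) (G G' : (Fin n → L) → M) :
    labelSum B (fun f => G f - G' f) = labelSum B G - labelSum B G' := by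
  simp [labelSum, smul_sub]

theorem labelSum_smul {n : ℕ} (B : Fin n → L → R) (r : R) (G : (Fin n → L) → M) :
    labelSum B (fun f => r • G f) = r • labelSum B G := by
  simp only [labelSum, Finset.smul_sum]
  exact Finset.sum_congr rfl fun f _ => smul_comm _ _ _

theorem labelSum_eq_split {n : ℕ} (B : Fin n → L → R) (G : (Fin n → L) → M) (a : Fin n) :
    labelSum B G = ∑ r : {j // j ≠ a} → L, (∏ j : {j // j ≠ a}, B j (r j)) •
      ∑ α, B a α • G ((Equiv.funSplitAt a L).symm (α, r)) := by
  rw [labelSum, ← (Equiv.funSplitAt a L).symm.sum_comp, Fintype.sum_prod_type_right]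
  refine Finset.sum_congr rfl fun r _ => ?_
  rw [Finset.smul_sum]
  refine Finset.sum_congr rfl fun α _ => ?_
  rw [smul_smul, Fintype.prod_eq_mul_prod_subtype_ne _ a, mul_comm]
  congr 2
  · exact Finset.prod_congr rfl fun j _ => by simp [Equiv.funSplitAt, Equiv.piSplitAt, j.2]
  · simp [Equiv.funSplitAt, Equiv.piSplitAt]

/-- Two sums over labellings agree if they agree after summing over the labels of one chord. -/
theorem labelSum_congr_at {n : ℕ} {B B' : Fin n → L → R} (a : Fin n)
    {G G' : (Fin n → L) → M} (hB : ∀ i, i ≠ a → B i = B' i)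
    (h : ∀ f : Fin n → L, ∑ α, B a α • G (Function.update f a α) =
      ∑ α, B' a α • G' (Function.update f a α)) :
    labelSum B G = labelSum B' G' := by
  rw [labelSum_eq_split _ _ a, labelSum_eq_split _ _ a]
  refine Finset.sum_congr rfl fun r _ => ?_
  congr 1
  · exact Finset.prod_congr rfl fun j _ => by rw [hB j j.2]
  -- Some value at `a` is needed to extend `r` to a full labelling; with no labels at all both sums
  -- are empty.
  · rcases isEmpty_or_nonempty L with hL | ⟨⟨α₀⟩⟩
    · simp
    · have key : ∀ α, (Equiv.funSplitAt a L).symm (α, r) =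
          Function.update ((Equiv.funSplitAt a L).symm (α₀, r)) a α := by
        intro α; funext j
        by_cases hj : j = a
        · subst hj; simp [Equiv.funSplitAt, Equiv.piSplitAt]
        · simp [Equiv.funSplitAt, Equiv.piSplitAt, hj]
      simpa only [← key] using h ((Equiv.funSplitAt a L).symm (α₀, r))

end LabelSum

/-! ### The twisted Lie algebra -/

theorem sum_grading {A : Type*} [AddCommMonoid A] (F : Grading → A) :
    ∑ α, F α = F 0 + F (1, 0) + F (0, 1) + F (1, 1) := by
  have : (Finset.univ : Finset Grading) = {0, (1, 0), (0, 1), (1, 1)} := by decide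
  rw [this, Finset.sum_insert (by decide), Finset.sum_insert (by decide),
    Finset.sum_insert (by decide), Finset.sum_singleton]
  simp only [add_assoc]

theorem grading_cases (α : Grading) : α = 0 ∨ α = (1, 0) ∨ α = (0, 1) ∨ α = (1, 1) := by
  revert α; decide

/-- The signs in the structure constants of the Lie algebra that is obtained from `A1_ε` by
twisting with the matrices `twist`. -/
def lieSign (α β : Grading) : ℤ :=
  if α = 0 ∨ β = 0 ∨ α = β then 0
  else if (α = (1, 0)) ∨ (α = (1, 1) ∧ β = (0, 1)) then 1 else -1

section Twisted

variable {R M : Type*} [CommRing R] [Ring M] [Algebra R M]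

/-- The structure constants of the twisted Lie algebra. -/
def lieConst (ε : R) (α β : Grading) : R :=
  (lieSign α β : R) * if α + β = (1, 0) then ε else 1

/-- The inverse of the invariant form of the twisted Lie algebra, where the entry that belongs to
the central basis vector is replaced by `t`. -/
def lieForm (ε t : R) (α : Grading) : R :=
  if α = 0 then t else if α = (1, 0) then ε else if α = (0, 1) then 1 else -1

/-- `X` represents the twisted Lie algebra, where the central basis vector is replaced by `1`, and
its Casimir element acts as `y`. -/
structure IsTwistedRep (ε y : R) (X : Grading → M) : Prop where
  eps : ε * ε = 1
  zero : X 0 = 1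
  comm : ∀ α β, X α * X β = X β * X α + lieConst ε α β • X (α + β)
  cas : ∑ α, lieForm ε 0 α • (X α * X α) = y • (1 : M)

theorem lieConst_self (ε : R) (α : Grading) : lieConst ε α α = 0 := by
  simp [lieConst, lieSign]

/-- The bracket with `γ` exchanges the labels `α` and `γ + α`, and the two coefficients cancel. The
central weight `t` is irrelevant because the central label has zero structure constants. -/
theorem lieForm_invariant (ε t : R) (α γ : Grading) :
    lieForm ε t α * lieConst ε γ α + lieForm ε t (γ + α) * lieConst ε γ (γ + α) = 0 := by
  rcases grading_cases α with rfl | rfl | rfl | rfl <;>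
  rcases grading_cases γ with rfl | rfl | rfl | rfl <;>
  simp +decide [lieForm, lieConst, lieSign]

/-- The entries of the degrees `(0,1)` and `(1,1)` cancel. The sum is the factor contributed by a
chord name that no longer occurs in a word. -/
theorem sum_lieForm (ε : R) : ∑ α, lieForm ε 0 α = ε := by
  simp +decide [sum_grading, lieForm]

theorem sum_lieForm_sq {ε : R} (hε : ε * ε = 1) :
    ∑ α, lieForm ε 0 α * lieForm ε 0 α = 3 := by
  simp +decide [sum_grading, lieForm, hε]; norm_num

/-- At central weight `0` the square of the form is the indicator of the nonzero labels. -/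
theorem lieForm_cube {ε : R} (hε : ε * ε = 1) (α : Grading) :
    lieForm ε 0 α * (lieForm ε 0 α * lieForm ε 0 α) = lieForm ε 0 α := by
  rcases grading_cases α with rfl | rfl | rfl | rfl <;> simp +decide [lieForm, hε]

/-- The contraction of two structure constants. -/
theorem lieConst_contract {ε : R} (hε : ε * ε = 1) (β γ : Grading) (F : Grading → Grading → M) :
    ∑ α, (lieForm ε 0 α * lieConst ε α β * lieConst ε α γ) • F (α + β) (α + γ) =
      ε • ((lieForm ε 0 β * lieForm ε 0 β * (lieForm ε 0 γ * lieForm ε 0 γ)) • F γ β -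
        (if β = γ then lieForm ε 0 β else 0) • ∑ δ, lieForm ε 0 δ • F δ δ) := by
  -- This is the cross-product identity. For distinct nonzero `β`, `γ` only `α = β + γ` survives,
  -- and it swaps them. For `β = γ ≠ 0` the swap term cancels the summand `δ = β` of the trace and
  -- leaves the two other labels.
  simp only [sum_grading]
  rcases grading_cases β with rfl | rfl | rfl | rfl <;>
  rcases grading_cases γ with rfl | rfl | rfl | rfl <;>
  simp +decide [lieForm, lieConst, lieSign, hε, smul_smul, smul_add, smul_sub,
    show (1 : ZMod 2) + 1 = 0 from rfl] <;> abel

/-- The two surviving values of `α` pair up into a commutator, which is again a multiple of `X β`.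
The squared form on the right only records `β ≠ 0`. -/
theorem IsTwistedRep.lieConst_fuse {ε y : R} {X : Grading → M} (h : IsTwistedRep ε y X)
    (β : Grading) :
    ∑ α, (lieForm ε 0 α * lieConst ε α β) • (X (α + β) * X α) =
      -(ε • ((lieForm ε 0 β * lieForm ε 0 β) • X β)) := by
  have h12 := h.comm (1, 0) (0, 1)
  have h23 := h.comm (0, 1) (1, 1)
  have h31 := h.comm (1, 1) (1, 0)
  simp only [sum_grading]
  rcases grading_cases β with rfl | rfl | rfl | rfl <;>
  simp +decide [lieForm, lieConst, lieSign, h.eps, 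
    show (1 : ZMod 2) + 1 = 0 from rfl] at h12 h23 h31 ⊢ <;>
  simp [h12, h23, h31, smul_add]

end Twisted

/-! ### Reduction of words to polynomials in the Casimir element -/

section Reduction

variable {R M : Type*} [CommRing R] [Ring M] [Algebra R M] {n : ℕ}

/-- The commutator of `X α` with the product of the labels of a word. -/
def lieDer (ε : R) (X : Grading → M) (α : Grading) (f : Fin n → Grading) : List (Fin n) → M
  | [] => 0
  | i :: l => lieConst ε α (f i) • (X (α + f i) * wordProd X f l) + X (f i) * lieDer ε X α f l

theorem IsTwistedRep.mul_wordProd {ε y : R} {X : Grading → M} (h : IsTwistedRep ε y X)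
    (α : Grading) (f : Fin n → Grading) (l : List (Fin n)) :
    X α * wordProd X f l = wordProd X f l * X α + lieDer ε X α f l := by
  induction l with
  | nil => simp [lieDer]
  | cons i l ih =>
    rw [wordProd_cons, ← mul_assoc, h.comm, add_mul, mul_assoc, ih, lieDer, smul_mul_assoc,
      mul_add, mul_assoc]
    abel

theorem lieDer_congr (ε : R) (X : Grading → M) (α : Grading) {f f' : Fin n → Grading}
    {l : List (Fin n)} (h : ∀ i ∈ l, f i = f' i) : lieDer ε X α f l = lieDer ε X α f' l := by
  induction l with
  | nil => rfl
  | cons i l ih =>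
    have hl : ∀ j ∈ l, f j = f' j := fun j hj => h j (List.mem_cons_of_mem _ hj)
    rw [lieDer, lieDer, ih hl, wordProd_congr X hl, h i List.mem_cons_self]

theorem lieDer_update (ε : R) (X : Grading → M) (α : Grading) (f : Fin n → Grading) {a : Fin n}
    (β : Grading) {l : List (Fin n)} (h : a ∉ l) :
    lieDer ε X α (Function.update f a β) l = lieDer ε X α f l :=
  lieDer_congr ε X α fun i hi => Function.update_of_ne (fun e => h (by rwa [e] at hi)) _ _

/-- The value of a word: the sum over all labellings, where the central label counts `t`. -/
def wordValue (ε t : R) (X : Grading → M) (l : List (Fin n)) : M :=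
  labelSum (fun _ => lieForm ε t) fun f => wordProd X f l

/-- The inserted factor is the indicator of `f b ≠ 0`, and the labellings with `f b = 0` already
have weight zero. -/
theorem labelSum_form_sq {ε : R} (hε : ε * ε = 1) (b : Fin n) (G : (Fin n → Grading) → M) :
    labelSum (fun _ => lieForm ε 0) (fun f => (lieForm ε 0 (f b) * lieForm ε 0 (f b)) • G f) =
      labelSum (fun _ => lieForm ε 0) G := by
  refine Finset.sum_congr rfl fun f _ => ?_
  rw [smul_smul, ← Finset.mul_prod_erase _ _ (Finset.mem_univ b), mul_right_comm,
    lieForm_cube hε]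

/-- A chord that does not occur contributes the factor `ε`. -/
theorem labelSum_forget {ε : R} (hε : ε * ε = 1) (a : Fin n) {G G' : (Fin n → Grading) → M}
    (h : ∀ f : Fin n → Grading, ∑ α, lieForm ε 0 α • G (Function.update f a α) = G' f)
    (hG' : ∀ (f : Fin n → Grading) α, G' (Function.update f a α) = G' f) :
    labelSum (fun _ => lieForm ε 0) G = ε • labelSum (fun _ => lieForm ε 0) G' := by
  rw [← labelSum_smul]
  refine labelSum_congr_at a (fun _ _ => rfl) fun f => ?_
  simp only [h, hG', smul_smul]
  rw [← Finset.sum_smul, ← Finset.sum_mul, sum_lieForm, hε, one_smul]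

/-- Rename the chord `b` to `c`. -/
def fuse (b c i : Fin n) : Fin n := if i = b then c else i

theorem notMem_map_fuse {b c : Fin n} (hbc : b ≠ c) (l : List (Fin n)) :
    b ∉ l.map (fuse b c) := by
  simp only [List.mem_map, not_exists, not_and, fuse]
  rintro x - h
  split_ifs at h with hx
  · exact hbc h.symm
  · exact hx h

theorem count_map_fuse {b c : Fin n} (hbc : b ≠ c) (l : List (Fin n)) (i : Fin n) :
    (l.map (fuse b c)).count i =
      if i = b then 0 else if i = c then l.count b + l.count c else l.count i := by
  induction l with
  | nil => simp
  | cons x l ih =>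
    simp only [List.map_cons, List.count_cons, ih, fuse, beq_iff_eq]
    grind

theorem wordProd_update_fuse (X : Grading → M) (f : Fin n → Grading) (b c : Fin n)
    (l : List (Fin n)) :
    wordProd X (Function.update f b (f c)) l = wordProd X f (l.map (fuse b c)) := by
  unfold wordProd
  rw [List.map_map]
  congr 1
  refine List.map_congr_left fun i _ => ?_
  simp only [Function.comp, fuse]
  split_ifs with h
  · simp [h]
  · simp [h]

/-- The swap term of `lieConst_contract` exchanges the ends of `b` and `c`. Its trace term forces
the labels of `b` and `c` to agree, so the remaining ends fuse to one chord `c`; the freed name `b`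
then serves for a new chord at the two vacated places. If `b = c` nothing is left to fuse, and the
sum over the label gives the factor `3`. -/
theorem wordValue_contract {ε : R} (hε : ε * ε = 1) (X : Grading → M) (b c : Fin n)
    (p u v r : List (Fin n))
    (hb : b = c → b ∉ p ∧ b ∉ u ∧ b ∉ v ∧ b ∉ r) :
    labelSum (fun _ => lieForm ε 0) (fun f : Fin n → Grading =>
      ∑ α, (lieForm ε 0 α * lieConst ε α (f b) * lieConst ε α (f c)) •
        (wordProd X f p * X (α + f b) * wordProd X f u * X (α + f c) * wordProd X f v *
          wordProd X f r)) =
    ε • (wordValue ε 0 X (p ++ c :: u ++ b :: v ++ r) -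
      if b = c then (3 : R) • wordValue ε 0 X (p ++ b :: u ++ b :: v ++ r)
      else wordValue ε 0 X (p.map (fuse b c) ++ b :: u.map (fuse b c) ++
        b :: v.map (fuse b c) ++ r.map (fuse b c))) := by
  simp only [fun f : Fin n → Grading => lieConst_contract hε (f b) (f c) fun β γ =>
    wordProd X f p * X β * wordProd X f u * X γ * wordProd X f v * wordProd X f r]
  rw [labelSum_smul, labelSum_sub]
  congr 2
  · simp only [mul_smul (lieForm ε 0 _ * lieForm ε 0 _)]
    rw [labelSum_form_sq hε, labelSum_form_sq hε]
    simp [wordValue, mul_assoc]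
  · split_ifs with hbc
    · subst hbc
      obtain ⟨h₁, h₂, h₃, h₄⟩ := hb rfl
      rw [wordValue, ← labelSum_smul]
      refine labelSum_congr_at b (fun _ _ => rfl) fun f => ?_
      simp only [if_true, wordProd_update X f _ h₁, wordProd_update X f _ h₂,
        wordProd_update X f _ h₃, wordProd_update X f _ h₄, Function.update_self,
        wordProd_append, wordProd_cons, ← mul_assoc]
      simp only [smul_smul]
      rw [← Finset.sum_smul, sum_lieForm_sq hε, Finset.smul_sum]
      exact Finset.sum_congr rfl fun α _ => by rw [smul_smul, mul_comm]
    · rw [wordValue, ← labelSum_form_sq hε c fun f => wordProd X f _]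
      refine labelSum_congr_at b (fun _ _ => rfl) fun f => ?_
      have hcb : ∀ α, Function.update f b α c = f c := fun α =>
        Function.update_of_ne (Ne.symm hbc) _ _
      simp only [Function.update_self, hcb, ite_smul, zero_smul, smul_ite, smul_zero,
        Finset.sum_ite_eq', Finset.mem_univ, if_true, wordProd_update_fuse, wordProd_append,
        wordProd_cons, ← mul_assoc, wordProd_update X f _ (notMem_map_fuse hbc _), smul_smul]
      rw [Finset.smul_sum]
      exact Finset.sum_congr rfl fun α _ => by
        rw [smul_smul, mul_comm _ (lieForm ε 0 α), ← mul_assoc]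

/-- Every chord name occurs twice or not at all. -/
def IsClosedWord (l : List (Fin n)) : Prop := ∀ i, l.count i = 0 ∨ l.count i = 2

variable {ε y : R} {X : Grading → M} {N : Subring M}

theorem smul_mem_of_algebraMap {r : R} (hr : algebraMap R M r ∈ N) {z : M} (hz : z ∈ N) :
    r • z ∈ N := by
  rw [Algebra.smul_def]; exact N.mul_mem hr hz

theorem three_smul_mem {z : M} (hz : z ∈ N) : (3 : R) • z ∈ N := by
  have : (3 : R) • z = z + z + z := by
    rw [show (3 : R) = 1 + 1 + 1 by norm_num]; simp [add_smul]
  rw [this]; exact N.add_mem (N.add_mem hz hz) hz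

/-- By the Leibniz rule the derivation hits the letters of `v` one at a time. Each hit contracts two
structure constants, so `wordValue_contract` turns it into values of words of the same length, which
`IH` covers. The list `u` collects the letters already passed. -/
theorem IsTwistedRep.labelSum_lieDer_mem (h : IsTwistedRep ε y X)
    (hεN : algebraMap R M ε ∈ N) {m : ℕ}
    (IH : ∀ l : List (Fin n), IsClosedWord l → l.length ≤ m → wordValue ε 0 X l ∈ N)
    (b : Fin n) (p r : List (Fin n)) : ∀ (v u : List (Fin n)),
    IsClosedWord (p ++ b :: u ++ v ++ r) → (p ++ b :: u ++ v ++ r).length ≤ m →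
    labelSum (fun _ => lieForm ε 0) (fun f : Fin n → Grading =>
      ∑ α, (lieForm ε 0 α * lieConst ε α (f b)) •
        (wordProd X f p * X (α + f b) * wordProd X f u * lieDer ε X α f v *
          wordProd X f r)) ∈ N := by
  intro v
  induction v with
  | nil => intro u _ _; simp [lieDer, labelSum, N.zero_mem]
  | cons c v ih =>
    intro u hc hm
    have hsplit : ∀ f : Fin n → Grading, ∑ α, (lieForm ε 0 α * lieConst ε α (f b)) •
        (wordProd X f p * X (α + f b) * wordProd X f u * lieDer ε X α f (c :: v) *
          wordProd X f r) =
        (∑ α, (lieForm ε 0 α * lieConst ε α (f b) * lieConst ε α (f c)) •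
          (wordProd X f p * X (α + f b) * wordProd X f u * X (α + f c) * wordProd X f v *
            wordProd X f r)) +
        ∑ α, (lieForm ε 0 α * lieConst ε α (f b)) •
          (wordProd X f p * X (α + f b) * wordProd X f (u ++ [c]) * lieDer ε X α f v *
          wordProd X f r) := by
      intro f
      rw [← Finset.sum_add_distrib]
      refine Finset.sum_congr rfl fun α _ => ?_
      simp only [lieDer, mul_add, add_mul, smul_add, mul_smul_comm, smul_mul_assoc, smul_smul,
        mul_assoc, wordProd_append, wordProd_cons, wordProd_nil, mul_one]
    simp only [hsplit]
    rw [labelSum_add]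
    refine N.add_mem ?_ (ih (u ++ [c]) (by simpa using hc) (by simpa using hm))
    have hcount : ∀ i, (p ++ b :: u ++ c :: v ++ r).count i =
        p.count i + u.count i + v.count i + r.count i + (if b = i then 1 else 0) +
          (if c = i then 1 else 0) := by
      intro i; simp [List.count_cons]; omega
    rw [wordValue_contract h.eps]
    · refine smul_mem_of_algebraMap hεN (N.sub_mem (IH _ ?_ ?_) ?_)
      · intro i
        have := hc i
        rw [hcount] at this
        have e : (p ++ c :: u ++ b :: v ++ r).count i =
            p.count i + u.count i + v.count i + r.count i + (if b = i then 1 else 0) +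
              (if c = i then 1 else 0) := by
          simp [List.count_cons]; omega
        rwa [e]
      · simpa using hm
      · split_ifs with hbc
        · subst hbc
          exact three_smul_mem (IH _ hc hm)
        -- One end each of `b` and `c` has been used up; the other two ends are joined to a chord
        -- named `c`.
        · refine IH _ ?_ (by simpa using hm)
          intro i
          have h1 := hc i
          have h2 := hc b
          have h3 := hc c
          rw [hcount] at h1 h2 h3
          simp only [List.count_append, List.count_cons, count_map_fuse hbc, beq_iff_eq]
          by_cases hib : i = b
          · subst hib; simp
          · by_cases hic : i = c
            · subst hic
              simp only [if_neg hib, if_neg hbc, if_true] at h1 h2 ⊢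
              omega
            · simp only [if_neg hib, if_neg hic, if_neg (Ne.symm hib), if_neg (Ne.symm hic)]
                at h1 ⊢
              omega
    · rintro rfl
      have := hc b
      rw [hcount] at this
      simp only [if_true] at this
      simp only [← List.count_eq_zero]
      omega

/-- Induction on the letters between the two ends of `a`: adjacent ends yield the Casimir element,
and each letter moved out from between them costs only words without `a`. -/
theorem IsTwistedRep.wordValue_mem_aux (h : IsTwistedRep ε y X)
    (hεN : algebraMap R M ε ∈ N) (hyN : algebraMap R M y ∈ N) {m : ℕ}
    (IH : ∀ l : List (Fin n), IsClosedWord l → l.length ≤ m → wordValue ε 0 X l ∈ N)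
    (a : Fin n) (r : List (Fin n)) : ∀ (u p : List (Fin n)),
    IsClosedWord (p ++ a :: u ++ a :: r) → (p ++ u ++ r).length ≤ m →
    wordValue ε 0 X (p ++ a :: u ++ a :: r) ∈ N := by
  intro u
  induction u with
  | nil =>
    intro p hc hm
    have ha : a ∉ p ∧ a ∉ r := by
      have := hc a
      simp only [List.count_append, List.count_cons, beq_self_eq_true, if_true] at this
      simp only [← List.count_eq_zero]
      omega
    -- The name `a` still ranges over all labels when its ends are gone. This gives a factor `ε`,
    -- which the extra `ε`, its own inverse, compensates.
    have e : wordValue ε 0 X (p ++ [a] ++ a :: r) = ε • y • wordValue ε 0 X (p ++ r) := by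
      rw [wordValue, wordValue, ← labelSum_smul]
      refine labelSum_forget h.eps a (fun f => ?_) fun f α => ?_
      · simp only [wordProd_append, wordProd_cons, wordProd_nil, mul_one, Function.update_self,
          wordProd_update X f _ ha.1, wordProd_update X f _ ha.2]
        have := congrArg (fun z => wordProd X f p * z * wordProd X f r) h.cas
        simpa [Finset.mul_sum, Finset.sum_mul, mul_assoc] using this
      · simp only [wordProd_append, wordProd_update X f _ ha.1, wordProd_update X f _ ha.2]
    rw [e]
    refine smul_mem_of_algebraMap hεN (smul_mem_of_algebraMap hyN (IH _ ?_ ?_))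
    · intro i
      have := hc i
      by_cases hi : i = a
      · subst hi; left; simp [List.count_eq_zero, ha.1, ha.2]
      · simpa [List.count_cons, Ne.symm hi] using this
    · simpa using hm
  | cons b u ih =>
    intro p hc hm
    have ha : a ≠ b ∧ a ∉ p ∧ a ∉ u ∧ a ∉ r := by
      have := hc a
      simp only [List.count_append, List.count_cons, beq_self_eq_true, if_true, beq_iff_eq] at this
      simp only [← List.count_eq_zero]
      by_cases hab : b = a
      · rw [if_pos hab] at this; omega
      · exact ⟨Ne.symm hab, by omega, by omega, by omega⟩
    have hfb : ∀ (f : Fin n → Grading) α, Function.update f a α b = f b := fun f α =>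
      Function.update_of_ne (Ne.symm ha.1) _ _
    have hcount : ∀ i, (p ++ a :: (b :: u) ++ a :: r).count i =
        p.count i + u.count i + r.count i + (if b = i then 1 else 0) +
          2 * (if a = i then 1 else 0) := by
      intro i
      simp only [List.count_append, List.count_cons, beq_iff_eq]
      omega
    have hclosed : IsClosedWord (p ++ b :: u ++ r) := by
      intro i
      have h1 := hc i
      rw [hcount] at h1
      by_cases hi : a = i
      · subst hi
        left
        simp [List.count_eq_zero, ha, Ne.symm ha.1]
      · simp only [hi, if_false] at h1
        simp only [List.count_append, List.count_cons, beq_iff_eq]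
        omega
    -- Moving the first end of `a` past `b` leaves a commutator `X (α + f b)` with `X α` still to
    -- the right of `u`. Moving this `X α` left across `u` gives the sum of `lieConst_fuse` and
    -- subtracts a derivation of `u`; the outer `ε` again compensates for the missing `a`.
    have e : wordValue ε 0 X (p ++ a :: (b :: u) ++ a :: r) =
        wordValue ε 0 X ((p ++ [b]) ++ a :: u ++ a :: r) +
        ε • (-(ε • wordValue ε 0 X (p ++ b :: u ++ r)) -
          labelSum (fun _ => lieForm ε 0) (fun f : Fin n → Grading =>
            ∑ α, (lieForm ε 0 α * lieConst ε α (f b)) •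
              (wordProd X f p * X (α + f b) * wordProd X f [] * lieDer ε X α f u *
                wordProd X f r))) := by
      rw [← sub_eq_iff_eq_add', wordValue, wordValue, wordValue, ← labelSum_sub,
        ← labelSum_form_sq h.eps b (fun f => wordProd X f (p ++ b :: u ++ r)),
        ← labelSum_smul, ← neg_one_smul R (labelSum _ _), ← labelSum_smul, ← labelSum_sub]
      refine labelSum_forget h.eps a (fun f => ?_) fun f α => ?_
      · simp only [wordProd_append, wordProd_cons, wordProd_nil, mul_one, Function.update_self,
          wordProd_update X f _ ha.2.1, wordProd_update X f _ ha.2.2.1,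
          wordProd_update X f _ ha.2.2.2, hfb]
        have key : ∀ α, lieForm ε 0 α • (wordProd X f p * (X α * (X (f b) * wordProd X f u)) *
            (X α * wordProd X f r) - wordProd X f p * X (f b) * (X α * wordProd X f u) *
            (X α * wordProd X f r)) =
            wordProd X f p * ((lieForm ε 0 α * lieConst ε α (f b)) • (X (α + f b) * X α)) *
              (wordProd X f u * wordProd X f r) -
            (lieForm ε 0 α * lieConst ε α (f b)) • (wordProd X f p * X (α + f b) *
              lieDer ε X α f u * wordProd X f r) := by
          intro α
          have h1 := h.mul_wordProd α f u
          have h2 : lieDer ε X α f u = X α * wordProd X f u - wordProd X f u * X α := by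
            rw [h1]; abel
          have h3 : lieConst ε α (f b) • X (α + f b) = X α * X (f b) - X (f b) * X α := by
            rw [h.comm α (f b)]; abel
          have h4 : ∀ z w : M, (lieForm ε 0 α * lieConst ε α (f b)) • (z * X (α + f b) * w) =
              lieForm ε 0 α • (z * (X α * X (f b) - X (f b) * X α) * w) := by
            intro z w
            rw [mul_smul, ← h3]; simp
          have h5 := h4 1 (X α)
          simp only [one_mul] at h5
          rw [mul_assoc (wordProd X f p * X (α + f b)), h4, h5, h2, mul_smul_comm,
            smul_mul_assoc, ← smul_sub]
          congr 1
          noncomm_ring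
        rw [Finset.sum_congr rfl fun α _ => key α, Finset.sum_sub_distrib, ← Finset.sum_mul,
          ← Finset.mul_sum, h.lieConst_fuse]
        simp [mul_assoc, smul_smul]
      · simp only [wordProd_append, wordProd_cons, wordProd_nil,
          wordProd_update X f _ ha.2.1, wordProd_update X f _ ha.2.2.1,
          wordProd_update X f _ ha.2.2.2, hfb, lieDer_update ε X _ f _ ha.2.2.1]
    rw [e]
    have hlen : (p ++ b :: u ++ r).length ≤ m := by simpa using hm
    refine N.add_mem (ih (p ++ [b]) ?_ ?_) (smul_mem_of_algebraMap hεN (N.sub_mem (N.neg_mem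
      (smul_mem_of_algebraMap hεN (IH _ hclosed hlen))) ?_))
    · intro i
      have h1 := hc i
      rw [hcount] at h1
      simp only [List.count_append, List.count_cons, List.count_nil, beq_iff_eq]
      omega
    · simpa using hm
    · exact h.labelSum_lieDer_mem hεN IH b p r u [] (by simpa using hclosed) (by simpa using hlen)

/-- The value of a closed word is a polynomial in the Casimir element. -/
theorem IsTwistedRep.wordValue_mem (h : IsTwistedRep ε y X)
    (hεN : algebraMap R M ε ∈ N) (hyN : algebraMap R M y ∈ N) :
    ∀ (m : ℕ) (l : List (Fin n)), IsClosedWord l → l.length ≤ m → wordValue ε 0 X l ∈ N := by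
  intro m
  induction m with
  | zero =>
    intro l _ hm
    obtain rfl : l = [] := List.length_eq_zero_iff.1 (by omega)
    have : wordValue ε 0 X ([] : List (Fin n)) = algebraMap R M ε ^ n := by
      simp only [wordValue, labelSum, wordProd_nil, ← Finset.sum_smul]
      rw [← Fintype.sum_pow, sum_lieForm, Algebra.smul_def, mul_one, map_pow]
    rw [this]
    exact N.pow_mem hεN _
  | succ m IH =>
    intro l hc hm
    cases l with
    | nil => exact IH [] hc (by simp)
    | cons a l =>
      have ha : a ∈ l := by
        have := hc a
        rw [List.count_cons_self] at this
        exact List.count_pos_iff.1 (by omega)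
      obtain ⟨u, r, rfl⟩ := List.append_of_mem ha
      refine h.wordValue_mem_aux hεN hyN IH a r u [] hc ?_
      simp at hm ⊢
      omega

end Reduction

/-! ### Dependence on the central weight, and the relations between values of words -/

section Values

variable {R M : Type*} [CommRing R] [Ring M] [Algebra R M] {n : ℕ}

theorem lieForm_eq_add (ε t : R) (α : Grading) :
    lieForm ε t α = lieForm ε 0 α + if α = 0 then t else 0 := by
  unfold lieForm; split_ifs <;> simp

theorem sum_lieForm_smul (ε t : R) (F : Grading → M) :
    ∑ α, lieForm ε t α • F α = ∑ α, lieForm ε 0 α • F α + t • F 0 := by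
  simp [lieForm_eq_add ε t, add_smul, Finset.sum_add_distrib]

theorem IsClosedWord.filter {l : List (Fin n)} (hl : IsClosedWord l) (p : Fin n → Bool) :
    IsClosedWord (l.filter p) := by
  intro i
  cases h : p i with
  | true => rw [List.count_filter h]; exact hl i
  | false => left; rw [List.count_eq_zero]; simp [h]

variable {ε y : R} {X : Grading → M}

theorem IsTwistedRep.wordProd_update_zero (h : IsTwistedRep ε y X) (f : Fin n → Grading)
    (a : Fin n) (l : List (Fin n)) :
    wordProd X (Function.update f a 0) l = wordProd X f (l.filter (· ≠ a)) := by
  induction l with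
  | nil => rfl
  | cons x l ih =>
    rw [wordProd_cons, ih]
    by_cases hx : x = a
    · subst hx; simp [h.zero]
    · simp [hx]

/-- The value of a closed word, where the central label is allowed on the chords in `T` and counts
`t`, is a polynomial in `t` and the Casimir element. -/
theorem IsTwistedRep.exists_polynomial {K : Type*} [CommRing K] [Algebra K R] {ε₀ : K}
    (hε₀ : algebraMap K R ε₀ = ε) (h : IsTwistedRep ε y X) (T : Finset (Fin n)) :
    ∀ l : List (Fin n), IsClosedWord l → ∃ P : MvPolynomial (Fin 2) K, ∀ t : R,
      labelSum (fun i => lieForm ε (if i ∈ T then t else 0)) (fun f => wordProd X f l) =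
        algebraMap R M (MvPolynomial.aeval ![t, y] P) := by
  induction T using Finset.induction_on with
  | empty =>
    intro l hl
    -- The reduction runs in the image of `K[y]`, which contains `ε` because `ε` comes from `K`.
    have hmem := h.wordValue_mem
      (N := ((Polynomial.aeval (R := K) y).range.toSubring).map (algebraMap R M))
      (Subring.mem_map.2 ⟨ε, ⟨Polynomial.C ε₀, by simp [hε₀]⟩, rfl⟩)
      (Subring.mem_map.2 ⟨y, ⟨Polynomial.X, by simp⟩, rfl⟩) _ l hl le_rfl
    obtain ⟨_, ⟨p, rfl⟩, hp⟩ := hmem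
    refine ⟨Polynomial.aeval (MvPolynomial.X 1) p, fun t => ?_⟩
    rw [← Polynomial.aeval_algHom_apply]
    simpa [wordValue] using hp.symm
  | insert i T hi ih =>
    intro l hl
    obtain ⟨P, hP⟩ := ih l hl
    obtain ⟨Q, hQ⟩ := ih _ (hl.filter (· ≠ i))
    -- Either the chord `i` avoids the extra central weight, or it takes the central label with
    -- weight `t` and disappears from the word. The factor `ε₀` offsets the free sum over the label
    -- of the name `i`.
    refine ⟨P + MvPolynomial.X 0 * MvPolynomial.C ε₀ * Q, fun t => ?_⟩
    have e : labelSum (fun j => lieForm ε (if j ∈ insert i T then t else 0))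
          (fun f => wordProd X f l) =
        labelSum (fun j => lieForm ε (if j ∈ T then t else 0))
          (fun f => wordProd X f l + (t * ε) • wordProd X f (l.filter (· ≠ i))) := by
      refine labelSum_congr_at i (fun j hj => ?_) fun f => ?_
      · simp [hj]
      · have hni : i ∉ l.filter (· ≠ i) := by simp
        simp only [Finset.mem_insert_self, if_true, hi, if_false, smul_add,
          Finset.sum_add_distrib, wordProd_update X f _ hni]
        rw [sum_lieForm_smul, ← Finset.sum_smul, sum_lieForm, smul_smul,
          h.wordProd_update_zero, mul_left_comm, h.eps, mul_one]
    rw [e, labelSum_add, labelSum_smul, hP, hQ]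
    simp [hε₀, Algebra.smul_def]

/-- The substitution `α ↦ γ + α` is an involution that pairs the terms of `lieForm_invariant`. It
says that the bracket with `γ`, applied to both ends of a chord, gives zero. -/
theorem sum_lieForm_invariant (ε t : R) (γ : Grading)
    (F : Grading → Grading → M) :
    ∑ α, lieForm ε t α • lieConst ε γ α • (F (γ + α) α + F α (γ + α)) = 0 := by
  have h2 : ∀ α, γ + (γ + α) = α := by revert γ; decide
  simp only [smul_add, Finset.sum_add_distrib]
  rw [← Equiv.sum_comp (Equiv.addLeft γ) fun α => lieForm ε t α • lieConst ε γ α • F α (γ + α),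
    ← Finset.sum_add_distrib]
  refine Finset.sum_eq_zero fun α _ => ?_
  simp only [Equiv.coe_addLeft, h2, smul_smul, ← add_smul, lieForm_invariant, zero_smul]

/-- The part of `lieDer` that comes from the ends of the chord `i`. -/
def lieDerAt (ε : R) (X : Grading → M) (α : Grading) (f : Fin n → Grading) (i : Fin n) :
    List (Fin n) → M
  | [] => 0
  | j :: l => (if j = i then lieConst ε α (f i) • (X (α + f i) * wordProd X f l) else 0) +
      X (f j) * lieDerAt ε X α f i l

theorem sum_lieDerAt (ε : R) (X : Grading → M) (α : Grading) (f : Fin n → Grading)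
    (l : List (Fin n)) : ∑ i, lieDerAt ε X α f i l = lieDer ε X α f l := by
  induction l with
  | nil => simp [lieDerAt, lieDer]
  | cons j l ih => simp [lieDerAt, lieDer, Finset.sum_add_distrib, ← Finset.mul_sum, ih]

theorem lieDerAt_append (ε : R) (X : Grading → M) (α : Grading) (f : Fin n → Grading)
    (i : Fin n) (l l' : List (Fin n)) : lieDerAt ε X α f i (l ++ l') =
      lieDerAt ε X α f i l * wordProd X f l' + wordProd X f l * lieDerAt ε X α f i l' := by
  induction l with
  | nil => simp [lieDerAt]
  | cons j l ih =>
    rw [List.cons_append, lieDerAt, lieDerAt, ih]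
    split_ifs <;> simp [mul_add, add_mul, mul_assoc, add_assoc]

theorem lieDerAt_of_notMem (ε : R) (X : Grading → M) (α : Grading) (f : Fin n → Grading)
    {i : Fin n} {l : List (Fin n)} (h : i ∉ l) : lieDerAt ε X α f i l = 0 := by
  induction l with
  | nil => rfl
  | cons j l ih =>
    simp only [List.mem_cons, not_or] at h
    rw [lieDerAt, ih h.2, if_neg (Ne.symm h.1)]; simp

theorem labelSum_zero {L : Type*} [Fintype L] (B : Fin n → L → R) :
    labelSum B (fun _ => (0 : M)) = 0 := by simp [labelSum]

theorem exists_split_of_count_two {i : Fin n} {l : List (Fin n)} (h : l.count i = 2) :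
    ∃ P Q S, l = P ++ i :: Q ++ i :: S ∧ i ∉ P ∧ i ∉ Q ∧ i ∉ S := by
  obtain ⟨P, l', rfl⟩ := List.append_of_mem (List.count_pos_iff.1 (by omega) : i ∈ l)
  have hP : List.count i P = 0 ∨ List.count i l' = 0 := by
    simp at h; omega
  by_cases hm : i ∈ l'
  · obtain ⟨Q, S, rfl⟩ := List.append_of_mem hm
    refine ⟨P, Q, S, by simp, ?_⟩
    simp at h
    simp only [← List.count_eq_zero]
    omega
  · have hl' := List.count_eq_zero.2 hm
    obtain ⟨Q, S, rfl⟩ := List.append_of_mem (List.count_pos_iff.1 (by simp at h; omega) : i ∈ P)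
    refine ⟨Q, S, l', by simp, ?_⟩
    simp at h
    simp only [← List.count_eq_zero]
    omega

/-- Carrying the first letter to the end costs a derivation of the rest, grouped here by chords. The
part of a chord other than `a` vanishes by invariance, and the remaining end of `a` gives the
bracket of a basis vector with itself. -/
theorem IsTwistedRep.wordValue_rotate (h : IsTwistedRep ε y X) (t : R) (a : Fin n)
    (l : List (Fin n)) (hl : IsClosedWord (a :: l)) :
    wordValue ε t X (a :: l) = wordValue ε t X (l ++ [a]) := by
  rw [← sub_eq_zero, wordValue, wordValue, ← labelSum_sub]
  simp only [wordProd_cons, wordProd_append, wordProd_nil, mul_one, h.mul_wordProd,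
    add_sub_cancel_left, ← sum_lieDerAt]
  have hsum : labelSum (fun _ => lieForm ε t)
      (fun f : Fin n → Grading => ∑ i, lieDerAt ε X (f a) f i l) =
      ∑ i, labelSum (fun _ => lieForm ε t) (fun f => lieDerAt ε X (f a) f i l) := by
    simp only [labelSum, Finset.smul_sum]
    exact Finset.sum_comm
  rw [hsum]
  refine Finset.sum_eq_zero fun i _ => ?_
  rw [← labelSum_zero (fun _ : Fin n => lieForm ε t)]
  refine labelSum_congr_at i (fun _ _ => rfl) fun f => ?_
  simp only [smul_zero, Finset.sum_const_zero]
  have hi := hl i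
  by_cases hia : i = a
  · subst hia
    have h1 : l.count i = 1 := by
      rw [List.count_cons_self] at hi; omega
    obtain ⟨P, Q, rfl⟩ := List.append_of_mem (List.count_pos_iff.1 (by omega) : i ∈ l)
    have hPQ : i ∉ P ∧ i ∉ Q := by
      simp at h1
      simp only [← List.count_eq_zero]
      omega
    simp [lieDerAt_append, lieDerAt, lieDerAt_of_notMem, hPQ, lieConst_self]
  · rw [List.count_cons_of_ne (Ne.symm hia)] at hi
    rcases hi with hi | hi
    · rw [List.count_eq_zero] at hi
      simp [lieDerAt_of_notMem _ _ _ _ hi]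
    · obtain ⟨P, Q, S, rfl, hP, hQ, hS⟩ := exists_split_of_count_two hi
      rw [← sum_lieForm_invariant ε t (f a) fun β γ =>
        wordProd X f P * X β * wordProd X f Q * X γ * wordProd X f S]
      refine Finset.sum_congr rfl fun α _ => ?_
      congr 1
      simp [lieDerAt_append, lieDerAt, lieDerAt_of_notMem, hP, hQ, hS, wordProd_update,
        Function.update_of_ne (Ne.symm hia), mul_assoc, mul_add]

theorem IsTwistedRep.wordValue_isRotated (h : IsTwistedRep ε y X) (t : R)
    {l l' : List (Fin n)} (hl : IsClosedWord l) (hr : l ~r l') :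
    wordValue ε t X l = wordValue ε t X l' := by
  obtain ⟨k, rfl⟩ := hr
  induction k generalizing l with
  | zero => simp
  | succ k ih =>
    cases l with
    | nil => simp
    | cons a l =>
      rw [List.rotate_cons_succ, h.wordValue_rotate t a l hl]
      refine ih fun i => ?_
      rw [(List.perm_append_singleton a l).count_eq i]; exact hl i

theorem wordValue_map_perm (ε t : R) (X : Grading → M) (σ : Equiv.Perm (Fin n))
    (l : List (Fin n)) : wordValue ε t X (l.map σ) = wordValue ε t X l := by
  rw [wordValue, wordValue, labelSum, labelSum,
    ← Equiv.sum_comp (σ.arrowCongr (Equiv.refl Grading))]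
  refine Finset.sum_congr rfl fun f _ => ?_
  congr 1
  · rw [← Equiv.prod_comp σ]; simp
  · simp [wordProd, Function.comp_def]

/-- The two differences are brackets of the moving end of `a` with the first and with the second end
of `b`. Summed over the label of `b` they cancel by invariance. -/
theorem IsTwistedRep.wordValue_fourTerm (h : IsTwistedRep ε y X) (t : R) (a b : Fin n)
    (U V W : List (Fin n)) (hg : IsGauss ([a] ++ U ++ [a, b] ++ V ++ [b] ++ W)) :
    wordValue ε t X ([a] ++ U ++ [a, b] ++ V ++ [b] ++ W) -
      wordValue ε t X ([a] ++ U ++ [b, a] ++ V ++ [b] ++ W) +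
      wordValue ε t X ([a] ++ U ++ [b] ++ V ++ [a, b] ++ W) -
      wordValue ε t X ([a] ++ U ++ [b] ++ V ++ [b, a] ++ W) = 0 := by
  have ha := hg a
  have hb := hg b
  simp only [List.count_append, List.count_cons, List.count_nil, beq_self_eq_true, if_true,
    beq_iff_eq] at ha hb
  have hab : a ≠ b := by
    rintro rfl; simp at ha
    omega
  have hU : b ∉ U ∧ b ∉ V ∧ b ∉ W := by
    simp only [← List.count_eq_zero]; omega
  rw [wordValue, wordValue, wordValue, wordValue, ← labelSum_sub, ← labelSum_add, ← labelSum_sub,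
    ← labelSum_zero (fun _ : Fin n => lieForm ε t)]
  refine labelSum_congr_at b (fun _ _ => rfl) fun f => ?_
  simp only [smul_zero, Finset.sum_const_zero]
  rw [← sum_lieForm_invariant ε t (f a) fun β γ =>
    X (f a) * wordProd X f U * X β * wordProd X f V * X γ * wordProd X f W]
  refine Finset.sum_congr rfl fun α _ => ?_
  congr 1
  have h3 : lieConst ε (f a) α • X (f a + α) = X (f a) * X α - X α * X (f a) := by
    rw [h.comm (f a) α]; abel
  have h4 : ∀ z w : M, lieConst ε (f a) α • (z * X (f a + α) * w) =
      z * (X (f a) * X α - X α * X (f a)) * w := by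
    intro z w; rw [← h3]; simp
  rw [smul_add, mul_assoc (_ * X (f a + α)), mul_assoc (_ * X (f a + α)), h4, h4]
  simp only [wordProd_append, wordProd_cons, wordProd_nil, mul_one, Function.update_self,
    Function.update_of_ne hab, wordProd_update X f _ hU.1, wordProd_update X f _ hU.2.1,
    wordProd_update X f _ hU.2.2]
  noncomm_ring

/-- The label sum of the isolated chord is the Casimir value plus the central weight, `y + (-y)`. -/
theorem IsTwistedRep.wordValue_isolated (h : IsTwistedRep ε y X) (a : Fin n)
    (U : List (Fin n)) (hg : IsGauss ([a, a] ++ U)) :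
    wordValue ε (-y) X ([a, a] ++ U) = 0 := by
  have ha : a ∉ U := by
    have := hg a
    simp at this
    simpa [← List.count_eq_zero] using this
  rw [wordValue, ← labelSum_zero (fun _ : Fin n => lieForm ε (-y))]
  refine labelSum_congr_at a (fun _ _ => rfl) fun f => ?_
  simp only [smul_zero, Finset.sum_const_zero]
  rw [sum_lieForm_smul]
  have := congrArg (fun z => z * wordProd X f U) h.cas
  simp only [Finset.sum_mul, smul_mul_assoc, one_mul] at this
  simp [wordProd_update X f _ ha, ← mul_assoc, h.zero, this]

end Values

/-! ### The twist -/

/-- Matrices with the commutation relations of the commuting factor. -/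
def twist (α : Grading) : Matrix (Fin 2) (Fin 2) ℤ :=
  if α = 0 then 1 else if α = (1, 0) then !![1, 0; 0, -1]
  else if α = (0, 1) then !![0, 1; 1, 0] else !![0, 1; -1, 0]

/-- The commuting factor, as an integer. -/
def commSign (α β : Grading) : ℤ := if α.1 * β.2 - α.2 * β.1 = 0 then 1 else -1

/-- The squares of the matrices `twist`. -/
def twistSq (α : Grading) : ℤ := if α = (1, 1) then -1 else 1

theorem twistSq_mul_self (α : Grading) : twistSq α * twistSq α = 1 := by
  revert α; decide

theorem lieConst_eq_zero {R : Type*} [CommRing R] (ε : R) {α β : Grading}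
    (h : α = 0 ∨ β = 0 ∨ α = β) : lieConst ε α β = 0 := by
  simp [lieConst, lieSign, h]

theorem lieConst_smul {R M : Type*} [CommRing R] [AddCommGroup M] [Module R M] (ε : R)
    (α β : Grading) (m : M) :
    lieConst ε α β • m = lieSign α β • (if α + β = (1, 0) then ε else 1) • m := by
  rw [lieConst, mul_smul, Int.cast_smul_eq_zsmul]

/-- The sign of `lieForm` in degree `(1,1)` is the square of the twist matrix. It is split off here,
to be cancelled later by the squares in `wordProd_twist`. -/
theorem prod_lieForm_smul {R M : Type*} [CommRing R] [AddCommGroup M] [Module R M] (ε t : R)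
    {n : ℕ} (f : Fin n → Grading) (m : M) :
    (∏ i, lieForm ε t (f i)) • m = (∏ i, twistSq (f i)) •
      ((∏ i, if f i = (1, 0) then ε else 1) * ∏ i, if f i = 0 then t else 1) • m := by
  rw [← Int.cast_smul_eq_zsmul R, smul_smul, Int.cast_prod, ← Finset.prod_mul_distrib,
    ← Finset.prod_mul_distrib]
  congr 1
  refine Finset.prod_congr rfl fun i _ => ?_
  rcases grading_cases (f i) with h | h | h | h <;> simp +decide [h, lieForm, twistSq]

theorem twist_zero : twist 0 = 1 := if_pos rfl

/-- These signs equal the commuting factor, so multiplying by the matrices turns color brackets into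
ordinary commutators. -/
theorem twist_mul_comm (α β : Grading) :
    twist α * twist β = commSign α β • (twist β * twist α) := by
  revert α β; decide

theorem twist_mul_self (α : Grading) : twist α * twist α = twistSq α • 1 := by
  revert α; decide

theorem twist_mul (α β : Grading) (h : ¬ (α = 0 ∨ β = 0 ∨ α = β)) :
    twist α * twist β = lieSign α β • twist (α + β) := by
  revert α β; decide

theorem commSign_sq (α β : Grading) : commSign α β * commSign α β = 1 := by
  unfold commSign; split_ifs <;> rfl

theorem twist_mul_wordProd {n : ℕ} (α : Grading) (f : Fin n → Grading) (l : List (Fin n)) :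
    twist α * wordProd twist f l =
      (l.map fun i => commSign α (f i)).prod • (wordProd twist f l * twist α) := by
  induction l with
  | nil => simp
  | cons i l ih =>
    rw [wordProd_cons, ← mul_assoc, twist_mul_comm, smul_mul_assoc, mul_assoc, ih,
      List.map_cons, List.prod_cons, mul_smul, mul_smul_comm, mul_assoc]

theorem crosses_filter {n : ℕ} {l : List (Fin n)} {i j a : Fin n} (hi : i ≠ a) (hj : j ≠ a) :
    Crosses l i j ↔ Crosses (l.filter (· ≠ a)) i j := by
  constructor
  · intro h
    have := List.Sublist.filter (fun x => decide (x ≠ a)) h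
    simpa [hi, hj, Crosses] using this
  · exact fun h => h.trans List.filter_sublist

theorem crosses_head {n : ℕ} {P Q : List (Fin n)} {a j : Fin n} (hP : a ∉ P) (hQ : a ∉ Q)
    (hj : j ≠ a) : Crosses (a :: (P ++ a :: Q)) a j ↔ j ∈ P ∧ j ∈ Q := by
  rw [Crosses, List.cons_sublist_cons]
  constructor
  · intro h
    obtain ⟨l₁, l₂, e, h₁, h₂⟩ := List.sublist_append_iff.1 h
    match l₁, e with
    | [], e =>
      rw [List.nil_append] at e
      subst e
      rw [List.cons_sublist_cons'] at h₂
      rcases h₂ with h₂ | h₂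
      · exact absurd (h₂.subset (by simp)) hQ
      · exact absurd h₂.1 hj
    | [x], e =>
      simp only [List.cons_append, List.nil_append, List.cons.injEq] at e
      obtain ⟨rfl, rfl⟩ := e
      exact ⟨h₁.subset (by simp), (List.cons_sublist_cons.1 h₂).subset (by simp)⟩
    | x :: x' :: l, e =>
      simp only [List.cons_append, List.cons.injEq] at e
      obtain ⟨rfl, rfl, -⟩ := e
      exact absurd (h₁.subset (by simp)) hP
  · rintro ⟨h₁, h₂⟩
    exact (List.singleton_sublist.2 h₁).append
      ((List.singleton_sublist.2 h₂).cons_cons a)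

/-- The matrices `twist` account for the signs of the crossings. -/
theorem wordProd_twist {n : ℕ} (f : Fin n → Grading) (m : ℕ) : ∀ l : List (Fin n),
    IsClosedWord l → l.length ≤ m → wordProd twist f l =
      ((∏ i ∈ l.toFinset, twistSq (f i)) *
        ∏ i, ∏ j, if Crosses l i j then commSign (f i) (f j) else 1) • 1 := by
  have hnil : wordProd twist f [] =
      ((∏ i ∈ ([] : List (Fin n)).toFinset, twistSq (f i)) *
        ∏ i, ∏ j, if Crosses [] i j then commSign (f i) (f j) else 1) • 1 := by
    simp [Crosses]
  induction m with
  | zero =>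
    intro l _ hm
    obtain rfl : l = [] := List.length_eq_zero_iff.1 (by omega)
    exact hnil
  | succ m ih =>
    intro l hl hm
    rcases l with - | ⟨a, l⟩
    · exact hnil
    have hal := hl a
    rw [List.count_cons_self] at hal
    obtain ⟨P, Q, rfl⟩ := List.append_of_mem (List.count_pos_iff.1 (by omega) : a ∈ l)
    have hPQ : a ∉ P ∧ a ∉ Q := by
      simp only [List.count_append, List.count_cons_self] at hal
      simp only [← List.count_eq_zero]; omega
    obtain ⟨hP, hQ⟩ := hPQ
    have hcl : IsClosedWord (P ++ Q) := by
      intro i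
      have := hl i
      simp only [List.count_append, List.count_cons, beq_iff_eq] at this ⊢
      by_cases h : a = i
      · subst h; left
        simp [List.count_eq_zero, hP, hQ]
      · simpa [h] using this
    have hIH := ih (P ++ Q) hcl (by simp at hm ⊢; omega)
    have hfilter : (a :: (P ++ a :: Q)).filter (· ≠ a) = P ++ Q := by
      have h1 : P.filter (· ≠ a) = P := List.filter_eq_self.2 fun x hx => by
        simpa using fun e : x = a => hP (e ▸ hx)
      have h2 : Q.filter (· ≠ a) = Q := List.filter_eq_self.2 fun x hx => by
        simpa using fun e : x = a => hQ (e ▸ hx)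
      simp only [List.filter_cons, List.filter_append, h1, h2]
      simp
    have hfin : (a :: (P ++ a :: Q)).toFinset = insert a (P ++ Q).toFinset := by
      ext x; simp
    -- Since `a` stands first, it can only be the first member of a crossing pair, and it crosses
    -- exactly the chords with ends on both sides of its second end.
    have hcross : ∀ i j, (if Crosses (a :: (P ++ a :: Q)) i j then commSign (f i) (f j) else 1) =
        (if i = a then (if j ∈ P ∧ j ∈ Q then commSign (f a) (f j) else 1) else 1) *
          (if Crosses (P ++ Q) i j then commSign (f i) (f j) else 1) := by
      intro i j
      by_cases hj : j = a
      · subst hj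
        have h1 : ¬ Crosses (j :: (P ++ j :: Q)) i j := by
          intro h
          rw [Crosses, List.cons_sublist_cons'] at h
          rcases h with h | ⟨rfl, h⟩
          · have := h.count_le j
            simp [List.count_cons, List.count_eq_zero.2 hP, List.count_eq_zero.2 hQ] at this
            omega
          · have := h.count_le i
            simp [List.count_eq_zero.2 hP, List.count_eq_zero.2 hQ] at this
        have h2 : ¬ Crosses (P ++ Q) i j := fun h => by
          have : j ∈ P ++ Q := h.subset (by simp)
          simp [hP, hQ] at this
        simp [h1, h2, hP]
      · by_cases hi : i = a
        · subst hi
          have h2 : ¬ Crosses (P ++ Q) i j := fun h => by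
            have : i ∈ P ++ Q := h.subset (by simp)
            simp [hP, hQ] at this
          simp only [crosses_head hP hQ hj, if_true, h2, if_false, mul_one]
        · have := crosses_filter (l := a :: (P ++ a :: Q)) hi hj
          rw [hfilter] at this
          simp only [this, if_neg hi, one_mul]
    -- This is the sign from moving the first matrix of `a` across `P` to the second. A chord with
    -- both ends in `P` contributes a square, hence `1`.
    have hsign : (P.map fun i => commSign (f a) (f i)).prod =
        ∏ j, if j ∈ P ∧ j ∈ Q then commSign (f a) (f j) else 1 := by
      rw [Finset.prod_list_map_count, Finset.prod_subset (Finset.subset_univ _)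
        (fun j _ hj => by
          rw [List.mem_toFinset] at hj
          rw [List.count_eq_zero.2 hj, pow_zero])]
      refine Finset.prod_congr rfl fun j _ => ?_
      have := hcl j
      rw [List.count_append] at this
      split_ifs with h
      · have h1 := List.count_pos_iff.2 h.1
        have h2 := List.count_pos_iff.2 h.2
        rw [show List.count j P = 1 by omega, pow_one]
      · have : List.count j P = 0 ∨ List.count j P = 2 := by
          by_contra hne
          exact h ⟨List.count_pos_iff.1 (by omega), List.count_pos_iff.1 (by omega)⟩
        rcases this with h0 | h0
        · rw [h0, pow_zero]
        · rw [h0, pow_two, commSign_sq]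
    have hprod : ∏ i, ∏ j, (if Crosses (a :: (P ++ a :: Q)) i j then
          commSign (f i) (f j) else 1) =
        (P.map fun i => commSign (f a) (f i)).prod *
          ∏ i, ∏ j, if Crosses (P ++ Q) i j then commSign (f i) (f j) else 1 := by
      simp only [hcross, Finset.prod_mul_distrib]
      rw [hsign]
      congr 1
      rw [Finset.prod_eq_single a (fun i _ hi => by simp [hi]) (by simp)]
      simp
    rw [hfin, Finset.prod_insert (by simp [hP, hQ]), hprod, wordProd_cons, wordProd_append,
      wordProd_cons, ← mul_assoc, twist_mul_wordProd, smul_mul_assoc, mul_assoc,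
      ← mul_assoc (twist _), twist_mul_self, smul_mul_assoc, one_mul, mul_smul_comm,
      ← wordProd_append, hIH, smul_smul, smul_smul]
    congr 1
    ring

/-! ### The twisted generators in 2×2 matrices over the enveloping algebra -/

section Envelope

variable {K : Type*} [Field K] (ε : K)

/-- The basis vectors, where the central one is replaced by `1`. -/
def oddGen (α : Grading) : Enveloping ε := if α = 0 then 1 else gen ε α

/-- The basis vectors, where the central one is replaced by `1`, twisted by matrices. -/
def twistedGen (α : Grading) : Matrix (Fin 2) (Fin 2) (Enveloping ε) :=
  Matrix.scalar (Fin 2) (oddGen ε α) * (Int.castRingHom (Enveloping ε)).mapMatrix (twist α)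

/-- Integers are central in the noncommutative ring `U`; this is why the twist matrices have integer
entries. -/
theorem commute_scalar_mapMatrix (u : Enveloping ε) (m : Matrix (Fin 2) (Fin 2) ℤ) :
    Commute (Matrix.scalar (Fin 2) u) ((Int.castRingHom (Enveloping ε)).mapMatrix m) := by
  ext i j
  simp [Matrix.scalar_apply, Matrix.diagonal_mul, Matrix.mul_diagonal,
    (Int.cast_commute (m i j) u).eq]

theorem commFactor_eq (α β : Grading) : commFactor K α β = (commSign α β : K) := by
  unfold commFactor commSign; split_ifs <;> simp

theorem wordProd_twistedGen {n : ℕ} (f : Fin n → Grading) (l : List (Fin n)) :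
    wordProd (twistedGen ε) f l = Matrix.scalar (Fin 2) (wordProd (oddGen ε) f l) *
      (Int.castRingHom (Enveloping ε)).mapMatrix (wordProd twist f l) := by
  induction l with
  | nil => simp
  | cons i l ih =>
    simp only [wordProd_cons, ih, twistedGen, map_mul]
    have := commute_scalar_mapMatrix ε (wordProd (oddGen ε) f l) (twist (f i))
    simp only [mul_assoc]
    rw [← mul_assoc ((Int.castRingHom (Enveloping ε)).mapMatrix (twist (f i))), ← this.eq,
      mul_assoc]

/-- Lets the central elements `H²` and `y` act as scalars on `U` and on the matrices over it. -/
instance : Algebra (Subalgebra.center K (Enveloping ε)) (Enveloping ε) where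
  algebraMap := (Subalgebra.center K (Enveloping ε)).val.toRingHom
  commutes' z u := ((Subalgebra.mem_center_iff.1 z.2) u).symm
  smul_def' _ _ := rfl

theorem scalar_algebraMap_smul (z : Subalgebra.center K (Enveloping ε)) (u : Enveloping ε) :
    Matrix.scalar (Fin 2) (z • u) = z • Matrix.scalar (Fin 2) u := by
  ext i j
  by_cases h : i = j <;> simp [Matrix.scalar_apply, h]

theorem yElem_coe : (yElem ε : Enveloping ε) = ε • (gen ε (1, 0) * gen ε (1, 0)) +
    gen ε (0, 1) * gen ε (0, 1) + gen ε (1, 1) * gen ε (1, 1) := by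
  rw [yElem, casimir]
  simp +decide only [AddSubgroupClass.coe_sub, SubmonoidClass.coe_pow, sum_grading, invForm,
    if_true, if_false, one_smul]
  rw [pow_two]
  abel

/-- For distinct nonzero degrees the commuting factor cancels against the sign of `twist_mul_comm`,
and `twist_mul` supplies the sign of the new bracket. In the Casimir element the entry `-1` of the
form meets a matrix of square `-1`. -/
theorem twistedGen_isTwistedRep (hε : ε = 1 ∨ ε = -1) :
    IsTwistedRep (algebraMap K (Subalgebra.center K (Enveloping ε)) ε) (yElem ε)
      (twistedGen ε) where
  eps := by rw [← map_mul]; rcases hε with rfl | rfl <;> simp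
  zero := by simp [twistedGen, oddGen, twist_zero]
  comm α β := by
    by_cases h : α = 0 ∨ β = 0 ∨ α = β
    · rw [lieConst_eq_zero _ h]
      rcases h with rfl | rfl | rfl <;> simp [twistedGen, oddGen, twist_zero]
    · have hα : α ≠ 0 := fun e => h (Or.inl e)
      have hβ : β ≠ 0 := fun e => h (Or.inr (Or.inl e))
      have hαβ : α + β ≠ 0 := fun e => h (Or.inr (Or.inr (by
        have h2 : ∀ γ δ : Grading, γ + δ = 0 → γ = δ := by decide
        exact h2 α β e)))
      have e1 : ∀ γ δ : Grading, twistedGen ε γ * twistedGen ε δ =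
          Matrix.scalar (Fin 2) (oddGen ε γ * oddGen ε δ) *
            (Int.castRingHom (Enveloping ε)).mapMatrix (twist γ * twist δ) := by
        intro γ δ
        simp only [twistedGen, map_mul, mul_assoc]
        rw [← mul_assoc ((Int.castRingHom (Enveloping ε)).mapMatrix (twist γ)),
          ← (commute_scalar_mapMatrix ε (oddGen ε δ) (twist γ)).eq, mul_assoc]
      rw [e1, e1]
      have e2 : oddGen ε α * oddGen ε β = commSign α β • (oddGen ε β * oddGen ε α) +
          structConst ε α β • oddGen ε (α + β) := by
        simp only [oddGen, if_neg hα, if_neg hβ, if_neg hαβ]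
        rw [gen_mul_gen, commFactor_eq, Int.cast_smul_eq_zsmul]
      have e3 : structConst ε α β • oddGen ε (α + β) =
          (if α + β = (1, 0) then algebraMap K (Subalgebra.center K (Enveloping ε)) ε else 1) •
            oddGen ε (α + β) := by
        rw [structConst_of h]; split_ifs <;> simp [algebraMap_smul]
      rw [e2, e3, map_add, add_mul]
      congr 1
      · rw [twist_mul_comm α β]
        simp only [map_zsmul, smul_mul_assoc, mul_smul_comm, smul_smul, commSign_sq, one_smul]
      · rw [twist_mul α β h, lieConst_smul, scalar_algebraMap_smul,
          map_zsmul, mul_smul_comm, smul_mul_assoc, twistedGen]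
  cas := by
    have hsq : ∀ α, twistedGen ε α * twistedGen ε α =
        twistSq α • Matrix.scalar (Fin 2) (oddGen ε α * oddGen ε α) := by
      intro α
      have := (commute_scalar_mapMatrix ε (oddGen ε α) (twist α)).eq
      rw [twistedGen, mul_assoc, ← mul_assoc _ (Matrix.scalar (Fin 2) _), ← this, mul_assoc,
        ← map_mul _ (twist α), twist_mul_self, ← mul_assoc, ← map_mul,
        map_zsmul, map_one, mul_smul_comm, mul_one]
    have h1 : (yElem ε) • (1 : Matrix (Fin 2) (Fin 2) (Enveloping ε)) =
        Matrix.scalar (Fin 2) (yElem ε : Enveloping ε) := by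
      rw [← map_one (Matrix.scalar (Fin 2)), ← scalar_algebraMap_smul]
      simp [Subalgebra.smul_def]
    rw [h1, yElem_coe]
    simp +decide only [sum_grading, hsq, lieForm, oddGen, twistSq, if_true, if_false, zero_smul,
      one_smul, map_add, zero_add, neg_smul, neg_neg, smul_neg, algebraMap_smul]
    congr 2
    ext i j
    by_cases h : i = j <;> simp [Matrix.scalar_apply, h]

theorem wordProd_smul {R A : Type*} [CommRing R] [Ring A] [Algebra R A] {n : ℕ}
    (h : Grading → R) (X : Grading → A) (f : Fin n → Grading) (l : List (Fin n)) :
    wordProd (fun α => h α • X α) f l = (l.map fun i => h (f i)).prod • wordProd X f l := by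
  induction l with
  | nil => simp
  | cons i l ih => simp [ih, smul_smul, mul_comm]

/-- The central basis vector `H`. -/
def centralGen : Subalgebra.center K (Enveloping ε) := ⟨gen ε 0, gen_zero_mem_center ε⟩

theorem casimir_eq : casimir ε = centralGen ε ^ 2 + yElem ε := by
  rw [yElem, centralGen, add_sub_cancel]

/-- The weight of a word, as the value of the word in the twisted algebra. -/
theorem scalar_wordWeight {n : ℕ} (d : GaussWord n) :
    Matrix.scalar (Fin 2) (wordWeight ε d) =
      wordValue (algebraMap K (Subalgebra.center K (Enveloping ε)) ε) (centralGen ε ^ 2)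
        (twistedGen ε) d.letters := by
  rw [wordWeight, map_sum, wordValue, labelSum]
  refine Finset.sum_congr rfl fun f _ => ?_
  set h : Grading → Subalgebra.center K (Enveloping ε) :=
    fun α => if α = 0 then centralGen ε else 1 with hh
  have hgen : gen ε = fun α => h α • oddGen ε α := by
    funext α
    by_cases hα : α = 0
    · simp [hh, hα, oddGen, centralGen, Subalgebra.smul_def]
    · simp [hh, hα, oddGen]
  -- Both ends of a chord with the central label carry `H`, so such a chord contributes `H²`.
  have hword : (d.letters.map fun i => gen ε (f i)).prod =
      (∏ i, h (f i) ^ 2) • wordProd (oddGen ε) f d.letters := by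
    have : (d.letters.map fun i => gen ε (f i)).prod = wordProd (gen ε) f d.letters := rfl
    rw [this, hgen, wordProd_smul, Finset.prod_list_map_count]
    congr 1
    have : d.letters.toFinset = Finset.univ := by
      ext i; simp [← List.count_pos_iff, d.gauss i]
    rw [this]
    exact Finset.prod_congr rfl fun i _ => by rw [d.gauss i]
  have hfin : d.letters.toFinset = Finset.univ := by
    ext i; simp [← List.count_pos_iff, d.gauss i]
  rw [hword, wordProd_twistedGen, wordProd_twist f _ d.letters (fun i => Or.inr (d.gauss i))
    le_rfl, hfin]
  have hcast : (∏ i, ∏ j, if Crosses d.letters i j then commFactor K (f i) (f j) else 1) =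
      ((∏ i, ∏ j, if Crosses d.letters i j then commSign (f i) (f j) else 1 : ℤ) : K) := by
    push_cast
    refine Finset.prod_congr rfl fun i _ => Finset.prod_congr rfl fun j _ => ?_
    split_ifs <;> simp [commFactor_eq]
  have hinv : ∀ α, (if α = (1, 0) then algebraMap K (Subalgebra.center K (Enveloping ε)) ε
      else 1) = algebraMap K _ (invForm ε α) := by
    intro α; unfold invForm; split_ifs <;> simp
  have hh2 : ∀ α, (if α = 0 then centralGen ε ^ 2 else 1) = h α ^ 2 := by
    intro α; rw [hh]; dsimp only; split_ifs <;> simp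
  rw [prod_lieForm_smul, hcast]
  simp only [hinv, hh2]
  set s : ℤ := ∏ i, ∏ j, if Crosses d.letters i j then commSign (f i) (f j) else 1
  rw [← map_prod, mul_comm (∏ i, invForm ε (f i)), mul_smul, Int.cast_smul_eq_zsmul, map_zsmul,
    ← algebraMap_smul (Subalgebra.center K (Enveloping ε)) (∏ i, invForm ε (f i)),
    smul_smul, scalar_algebraMap_smul, map_zsmul, map_one, mul_smul_comm, mul_one,
    smul_comm _ (_ * s), smul_smul, ← mul_assoc, ← Finset.prod_mul_distrib]
  -- The squares of the twists come once from the form and once from the word, and cancel.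
  simp only [twistSq_mul_self, Finset.prod_const_one, one_mul]

end Envelope

/-! ### Algebraic independence -/

section Independence

variable {K : Type*} [Field K] (ε : K)

/-- The universal property of the enveloping algebra, in terms of the basis vectors. -/
theorem exists_envelopingLift {A : Type*} [Ring A] [Algebra K A] (ρ : Grading → A)
    (h : ∀ α β, ρ α * ρ β = commFactor K α β • (ρ β * ρ α) + structConst ε α β • ρ (α + β)) :
    ∃ φ : Enveloping ε →ₐ[K] A, ∀ α, φ (gen ε α) = ρ α := by
  let L : TensorAlgebra K (A1 K) →ₐ[K] A :=
    TensorAlgebra.lift K (Fintype.linearCombination K ρ)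
  have hL : ∀ X : A1 K, L (TensorAlgebra.ι K X) = ∑ α, X α • ρ α := fun X => by
    simp [L, Fintype.linearCombination_apply]
  have hb : ∀ α, L (TensorAlgebra.ι K (basisVec K α)) = ρ α := fun α => by
    rw [hL]; simp [basisVec, Pi.single_apply]
  have hrel : ∀ ⦃x y⦄, EnvelopingRel ε x y → L x = L y := by
    rintro _ _ ⟨X, Y⟩
    have e : L (TensorAlgebra.ι K (bracket ε X Y)) =
        ∑ α, ∑ β, (structConst ε α β * X α * Y β) • ρ (α + β) := by
      simp only [bracket, map_sum, map_smul, hb]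
    rw [map_mul, map_add, e, braid, hL, hL, Finset.sum_mul_sum]
    simp only [map_sum, map_smul, map_mul, hb, ← Finset.sum_add_distrib]
    refine Finset.sum_congr rfl fun α _ => Finset.sum_congr rfl fun β _ => ?_
    rw [smul_mul_smul_comm, h α β, smul_add, smul_smul, smul_smul]
    congr 2 <;> ring
  refine ⟨RingQuot.liftAlgHom K ⟨L, hrel⟩, fun α => ?_⟩
  rw [gen, Enveloping.mk]
  exact (RingQuot.liftAlgHom_mkAlgHom_apply K L hrel _).trans (hb α)

/-- The coefficients of the lowering part of the representation. -/
def lowerCoeff (lam : K) (k : ℤ) : K := -(ε * (k * lam + k * (k - 1) / 2) / 2)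

/-- The operator that combines the neighbours of an entry of a sequence. -/
def tridiag (d u l : ℤ → K) : Module.End K (ℤ → K) where
  toFun g k := d k * g k + u k * g (k + 1) + l k * g (k - 1)
  map_add' g g' := by funext k; simp only [Pi.add_apply]; ring
  map_smul' r g := by funext k; simp only [Pi.smul_apply, smul_eq_mul, RingHom.id_apply]; ring

/-- A representation of `A1_ε` on sequences, with two parameters. -/
def seqRep (lam mu : K) (α : Grading) : Module.End K (ℤ → K) :=
  if α = 0 then tridiag (fun _ => mu) 0 0
  else if α = (1, 0) then tridiag (fun k => (-1) ^ k * (lam + k)) 0 0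
  else if α = (0, 1) then tridiag 0 1 (lowerCoeff ε lam)
  else tridiag 0 (fun k => -(-1) ^ k) (fun k => (-1) ^ k * lowerCoeff ε lam k)

theorem neg_one_zpow_mul_self (k : ℤ) : ((-1 : K) ^ k) * (-1) ^ k = 1 := by
  rw [← mul_zpow]; simp

theorem neg_one_zpow_add_one (k : ℤ) : (-1 : K) ^ (k + 1) = -(-1) ^ k := by
  rw [zpow_add_one₀ (by simp)]; simp

theorem neg_one_zpow_sub_one (k : ℤ) : (-1 : K) ^ (k - 1) = -(-1) ^ k := by
  rw [zpow_sub_one₀ (by simp)]; simp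

variable [CharZero K]

/-- `Q₁` is diagonal, while `Q₂` and `Q₃` combine the two shifts. The bracket of these two requires
`lowerCoeff` at `k + 1` minus `lowerCoeff` at `k` to be `-ε (lam + k) / 2`; `lowerCoeff` is the
solution that vanishes at `k = 0`. -/
theorem seqRep_comm (lam mu : K) (α β : Grading) :
    seqRep ε lam mu α * seqRep ε lam mu β =
      commFactor K α β • (seqRep ε lam mu β * seqRep ε lam mu α) +
        structConst ε α β • seqRep ε lam mu (α + β) := by
  ext g k
  have hs : (-1 : K) ^ k = 1 ∨ (-1 : K) ^ k = -1 :=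
    mul_self_eq_one_iff.1 (neg_one_zpow_mul_self k)
  rcases grading_cases α with rfl | rfl | rfl | rfl <;>
  rcases grading_cases β with rfl | rfl | rfl | rfl <;>
  simp +decide [seqRep, tridiag, commFactor, structConst, lowerCoeff, neg_one_zpow_add_one,
    neg_one_zpow_sub_one] <;>
  rcases hs with hs | hs <;> (try simp only [hs]) <;> ring_nf

theorem seqRep_casimir (lam mu : K) :
    ε • (seqRep ε lam mu (1, 0) * seqRep ε lam mu (1, 0)) +
      seqRep ε lam mu (0, 1) * seqRep ε lam mu (0, 1) +
      seqRep ε lam mu (1, 1) * seqRep ε lam mu (1, 1) =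
    algebraMap K _ (ε * (lam * (lam - 1))) := by
  ext g k
  have hs : (-1 : K) ^ k = 1 ∨ (-1 : K) ^ k = -1 :=
    mul_self_eq_one_iff.1 (neg_one_zpow_mul_self k)
  simp +decide [seqRep, tridiag, lowerCoeff, neg_one_zpow_add_one,
    neg_one_zpow_sub_one, Algebra.algebraMap_eq_smul_one]
  rcases hs with hs | hs <;> simp only [hs] <;> ring

/-- In `seqRep` the elements `H²` and `y` act by `mu²` and `ε lam (lam - 1)`, chosen independently
from infinite sets, so a polynomial relation must be trivial. -/
theorem algebraicIndependent_casimir {ε : K} (hε : ε ≠ 0) :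
    AlgebraicIndependent K ![casimir ε, yElem ε] := by
  rw [algebraicIndependent_iff]
  intro P hP
  have hval : ∀ lam mu : K,
      MvPolynomial.aeval ![mu ^ 2 + ε * (lam * (lam - 1)), ε * (lam * (lam - 1))] P = 0 := by
    intro lam mu
    obtain ⟨φ, hφ⟩ := exists_envelopingLift ε (seqRep ε lam mu) (seqRep_comm ε lam mu)
    let ψ := φ.comp (Subalgebra.center K (Enveloping ε)).val
    have hH : ψ (centralGen ε) = algebraMap K _ mu := by
      show φ (gen ε 0) = _
      rw [hφ]
      ext g k
      simp [seqRep, tridiag, Algebra.algebraMap_eq_smul_one]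
    have hy : ψ (yElem ε) = algebraMap K _ (ε * (lam * (lam - 1))) := by
      show φ (yElem ε : Enveloping ε) = _
      rw [yElem_coe, ← seqRep_casimir ε lam mu]
      simp only [map_add, map_smul, map_mul, hφ]
    have hc : ψ (casimir ε) = algebraMap K _ (mu ^ 2 + ε * (lam * (lam - 1))) := by
      rw [casimir_eq, map_add, map_pow, hH, hy, map_add, map_pow]
    have h0 := congrArg ψ hP
    have h1 : ψ.comp (MvPolynomial.aeval ![casimir ε, yElem ε]) =
        (Algebra.ofId K (Module.End K (ℤ → K))).comp (MvPolynomial.aeval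
          ![mu ^ 2 + ε * (lam * (lam - 1)), ε * (lam * (lam - 1))]) := by
      refine MvPolynomial.algHom_ext fun i => ?_
      fin_cases i
      · simpa [Algebra.ofId_apply] using hc
      · simpa [Algebra.ofId_apply] using hy
    have h2 := DFunLike.congr_fun h1 P
    rw [AlgHom.comp_apply, h0, map_zero, AlgHom.comp_apply, Algebra.ofId_apply] at h2
    exact (algebraMap K (Module.End K (ℤ → K))).injective (by rw [← h2, map_zero])
  -- The substitution passes from the variables `c`, `y` to `H²`, `y`, whose values are independent;
  -- it is inverted at the end.
  have hP' : MvPolynomial.aeval ![MvPolynomial.X 0 + MvPolynomial.X 1, MvPolynomial.X 1] P =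
      (0 : MvPolynomial (Fin 2) K) := by
    refine MvPolynomial.funext_set ![Set.range fun mu : K => mu ^ 2,
      Set.range fun lam : K => ε * (lam * (lam - 1))] ?_ ?_
    · intro i
      have hcast : ∀ m n : ℕ, (m : K) * m = n * n → m = n := fun m n e => by
        exact Nat.mul_self_inj.1 (by exact_mod_cast e)
      fin_cases i
      · refine Set.infinite_of_injective_forall_mem (f := fun n : ℕ => (n : K) ^ 2)
          (fun m n e => hcast m n (by simpa [pow_two] using e)) fun n => ⟨n, rfl⟩
      -- Starting at `lam = n + 1` keeps the values distinct, since `lam = 0` and `lam = 1` give the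
      -- same one.
      · refine Set.infinite_of_injective_forall_mem
          (f := fun n : ℕ => ε * (((n : K) + 1) * ((n + 1) - 1))) (fun m n e => ?_)
          fun n => ⟨n + 1, rfl⟩
        have e' : ((m : K) + 1) * m = (n + 1) * n := by
          simpa using mul_left_cancel₀ (fun h0 => hε h0) e
        have e2 : (m + 1) * m = (n + 1) * n := by exact_mod_cast e'
        nlinarith [lt_trichotomy m n]
    · intro x hx
      obtain ⟨mu, hmu⟩ : x 0 ∈ Set.range fun mu : K => mu ^ 2 := hx 0 trivial
      obtain ⟨lam, hlam⟩ : x 1 ∈ Set.range fun lam : K => ε * (lam * (lam - 1)) := hx 1 trivial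
      have := hval lam mu
      rw [map_zero, ← MvPolynomial.coe_aeval_eq_eval, RingHom.coe_coe, ← AlgHom.comp_apply,
        MvPolynomial.comp_aeval, ← this]
      congr 2
      funext i
      fin_cases i <;> simp [← hmu, ← hlam]
  have := congrArg (MvPolynomial.aeval (R := K)
    ![(MvPolynomial.X 0 - MvPolynomial.X 1 : MvPolynomial (Fin 2) K), MvPolynomial.X 1]) hP'
  rw [← AlgHom.comp_apply, MvPolynomial.comp_aeval, map_zero] at this
  rw [← this]
  conv_lhs => rw [← MvPolynomial.aeval_X_left_apply P]
  congr 2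
  funext i
  fin_cases i <;> simp

end Independence

/-! ### Deleting chords -/

section Deletion

variable {R M : Type*} [CommRing R] [Ring M] [Algebra R M]

/-- The values of `X`, and `1` for a deleted chord. -/
def optGen (X : Grading → M) (o : Option Grading) : M := X (o.getD 0)

/-- The weights of the labels, and `r` for a deleted chord. -/
def optForm (ε t r : R) : Option Grading → R
  | none => r
  | some α => lieForm ε t α

/-- The number of deleted chords. -/
def missing {n : ℕ} (f : Fin n → Option Grading) : ℕ := ∑ i, if f i = none then 1 else 0

/-- The sum of the values of the words that are obtained by deleting `k` chords. -/
def deletedValue (ε t : R) (X : Grading → M) {n : ℕ} (k : ℕ) (l : List (Fin n)) : M :=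
  ∑ f : Fin n → Option Grading, if missing f = k then
    (∏ i, optForm ε t 1 (f i)) • wordProd (optGen X) f l else 0

/-- A deleted chord reads as the central label, where `X` is `1`, so its ends may stay in the word.
The extra value `none` only separates deletion from a genuine central label, which has its own
weight. -/
theorem wordProd_insertNth {X : Grading → M} (hX : X 0 = 1) {n : ℕ} (a : Fin (n + 1))
    (f : Fin n → Option Grading) (l : List (Fin (n + 1))) :
    wordProd (optGen X) (Fin.insertNth a none f) l =
      wordProd (optGen X) f (l.filterMap (finSuccEquiv' a)) := by
  induction l with
  | nil => simp
  | cons x l ih =>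
    rw [wordProd_cons, ih]
    rcases Fin.eq_self_or_eq_succAbove a x with rfl | ⟨j, rfl⟩
    · simp [optGen, hX]
    · simp

theorem deletedValue_filterMap (ε t : R) {X : Grading → M} (hX : X 0 = 1) {n : ℕ} (k : ℕ)
    (a : Fin (n + 1)) (l : List (Fin (n + 1))) :
    deletedValue ε t X k (l.filterMap (finSuccEquiv' a)) =
      ∑ f : Fin (n + 1) → Option Grading, if f a = none then (if missing f = k + 1 then
        (∏ i, optForm ε t 1 (f i)) • wordProd (optGen X) f l else 0) else 0 := by
  rw [← Equiv.sum_comp (Fin.insertNthEquiv (fun _ => Option Grading) a),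
    Fintype.sum_prod_type, Finset.sum_eq_single none]
  · refine Finset.sum_congr rfl fun f _ => ?_
    have h1 : missing (Fin.insertNth (α := fun _ => Option Grading) a none f) =
        missing f + 1 := by
      rw [missing, Fin.sum_univ_succAbove _ a, add_comm]
      simp only [Fin.insertNth_apply_same, Fin.insertNth_apply_succAbove, if_true]
      rfl
    have h2 : ∏ i, optForm ε t 1 (Fin.insertNth (α := fun _ => Option Grading) a none f i) =
        ∏ i, optForm ε t 1 (f i) := by
      rw [Fin.prod_univ_succAbove _ a]
      simp only [Fin.insertNth_apply_same, Fin.insertNth_apply_succAbove]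
      exact one_mul _
    have h3 : Fin.insertNthEquiv (fun _ => Option Grading) a (none, f) =
        Fin.insertNth a none f := rfl
    simp only [h3, Fin.insertNth_apply_same, if_true, h1, h2,
      wordProd_insertNth hX, add_left_inj]
  · intro o _ ho
    simp [ho]
  · simp

/-- A set of `k + 1` deleted chords arises once for each choice of the member deleted first.
Iterated, these factors give the `k!` that the deframing operator divides out. -/
theorem sum_deletedValue (ε t : R) {X : Grading → M} (hX : X 0 = 1) {n : ℕ} (k : ℕ)
    (l : List (Fin (n + 1))) :
    ∑ a, deletedValue ε t X k (l.filterMap (finSuccEquiv' a)) =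
      (k + 1) • deletedValue ε t X (k + 1) l := by
  simp only [deletedValue_filterMap ε t hX]
  rw [Finset.sum_comm, deletedValue, Finset.smul_sum]
  refine Finset.sum_congr rfl fun f _ => ?_
  split_ifs with h
  · rw [← h, missing, Finset.sum_smul]
    exact Finset.sum_congr rfl fun a _ => by split_ifs <;> simp
  · simp

theorem labelSum_comp {L L' : Type*} [Fintype L] [Fintype L'] [DecidableEq L'] {n : ℕ}
    (π : L → L') (B : Fin n → L → R) (G : (Fin n → L') → M) :
    labelSum B (fun f => G (π ∘ f)) =
      labelSum (fun i α => ∑ o with π o = α, B i o) G := by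
  rw [labelSum, labelSum, ← Finset.sum_fiberwise _ (fun f : Fin n → L => π ∘ f)]
  refine Finset.sum_congr rfl fun h _ => ?_
  rw [Finset.prod_univ_sum, Finset.sum_smul]
  refine Finset.sum_congr ?_ fun f hf => ?_
  · ext f; simp [Fintype.mem_piFinset, funext_iff]
  · rw [Fintype.mem_piFinset] at hf
    have : π ∘ f = h := funext fun i => by simpa using hf i
    rw [this]

theorem missing_le {n : ℕ} (f : Fin n → Option Grading) : missing f ≤ n := by
  refine (Finset.sum_le_card_nsmul _ _ 1 fun i _ => ?_).trans (by simp)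
  split_ifs <;> simp

theorem missing_zero_zero (f : Fin 0 → Option Grading) : missing f = 0 := by simp [missing]

/-- Deleting chords with a factor `r` amounts to adding `r` to the weight of the central label. -/
theorem sum_pow_smul_deletedValue (ε t r : R) (X : Grading → M) {n : ℕ} (l : List (Fin n)) :
    ∑ k ∈ Finset.range (n + 1), r ^ k • deletedValue ε t X k l =
      wordValue ε (t + r) X l := by
  have h1 : ∀ f : Fin n → Option Grading, r ^ missing f * ∏ i, optForm ε t 1 (f i) =
      ∏ i, optForm ε t r (f i) := by
    intro f
    rw [missing, ← Finset.prod_pow_eq_pow_sum, ← Finset.prod_mul_distrib]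
    refine Finset.prod_congr rfl fun i _ => ?_
    cases f i <;> simp [optForm]
  have h2 : ∑ k ∈ Finset.range (n + 1), r ^ k • deletedValue ε t X k l =
      labelSum (fun _ => optForm ε t r)
        (fun f : Fin n → Option Grading => wordProd X ((fun o => o.getD 0) ∘ f) l) := by
    simp only [deletedValue, Finset.smul_sum]
    rw [Finset.sum_comm, labelSum]
    refine Finset.sum_congr rfl fun f _ => ?_
    rw [Finset.sum_eq_single (missing f) (fun k _ hk => by simp [Ne.symm hk])
      (fun h => absurd (Finset.mem_range.2 (Nat.lt_succ_of_le (missing_le f))) h), if_pos rfl,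
      smul_smul, h1]
    rfl
  rw [h2, labelSum_comp (fun o : Option Grading => o.getD 0) _ fun h => wordProd X h l, wordValue]
  congr 1
  funext i α
  rw [Finset.sum_filter, Fintype.sum_option]
  simp only [Option.getD_none, Option.getD_some, Finset.sum_ite_eq', Finset.mem_univ, if_true,
    optForm]
  rw [lieForm_eq_add ε t, lieForm_eq_add ε (t + r)]
  by_cases h : α = 0
  · simp [h]; ring
  · simp [h, Ne.symm h]

theorem deletedValue_zero (ε t : R) (X : Grading → M) {n : ℕ} (l : List (Fin n)) :
    deletedValue ε t X 0 l = wordValue ε t X l := by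
  have h := sum_pow_smul_deletedValue ε t 0 X l
  rw [add_zero, Finset.sum_eq_single 0 (fun k _ hk => by rw [zero_pow hk, zero_smul])
    (fun h0 => absurd (Finset.mem_range.2 n.succ_pos) h0), pow_zero, one_smul] at h
  exact h

/-- The new chord's label sum is the Casimir value plus the central weight; at `t = H²` it equals
`c`. -/
theorem IsTwistedRep.wordValue_addIsolated {ε y : R} {X : Grading → M} (h : IsTwistedRep ε y X)
    (t : R) {n : ℕ} (l : List (Fin n)) :
    wordValue ε t X (l.map Fin.castSucc ++ [Fin.last n, Fin.last n]) =
      (t + y) • wordValue ε t X l := by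
  rw [wordValue, wordValue, labelSum, labelSum,
    ← Equiv.sum_comp (Fin.snocEquiv fun _ => Grading), Fintype.sum_prod_type_right,
    Finset.smul_sum]
  refine Finset.sum_congr rfl fun f _ => ?_
  have hw : ∀ α, wordProd X (Fin.snoc (α := fun _ => Grading) f α) (l.map Fin.castSucc) =
      wordProd X f l := by
    intro α; simp [wordProd, Function.comp_def]
  have hc : ∑ α, lieForm ε t α • (X α * X α) = (t + y) • (1 : M) := by
    rw [sum_lieForm_smul, h.cas, h.zero, add_smul, mul_one, add_comm]
  have := congrArg (fun z => (∏ i, lieForm ε t (f i)) • (wordProd X f l * z)) hc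
  simp only [Finset.mul_sum, Finset.smul_sum, mul_smul_comm, mul_one] at this
  rw [smul_comm, ← this]
  refine Finset.sum_congr rfl fun α _ => ?_
  simp [Fin.snocEquiv, Fin.prod_univ_castSucc, hw, mul_smul]

end Deletion

/-! ### The weight systems -/

section WeightSystem

variable {K : Type*} [Field K]

theorem framedSpace_ext {n : ℕ} {N : Type*} [AddCommGroup N] [Module K N]
    {f g : FramedSpace K n →ₗ[K] N} (h : ∀ d, f (cls K d) = g (cls K d)) : f = g := by
  refine Submodule.linearMap_qext _ (Finsupp.lhom_ext' fun D => LinearMap.ext_ring ?_)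
  induction D using Quotient.inductionOn with
  | _ d => exact h d

theorem thetaMap_cls {n : ℕ} (d : GaussWord n) :
    thetaMap K n (cls K d) = cls K d.addIsolated := by
  rw [thetaMap, cls, Submodule.liftQ_apply, Finsupp.linearCombination_single, one_smul]
  rfl

theorem sMap_cls {n : ℕ} (d : GaussWord (n + 1)) :
    sMap K n (cls K d) = ∑ a, cls K (d.delete a) := by
  rw [sMap, cls, Submodule.liftQ_apply, Finsupp.linearCombination_single, one_smul]
  rfl

variable {ε : K}

/-- The base change of the parameter to the center. -/
abbrev centerParam (ε : K) : Subalgebra.center K (Enveloping ε) := algebraMap K _ ε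

theorem algebraMap_center_eq (z : Subalgebra.center K (Enveloping ε)) :
    algebraMap _ (Matrix (Fin 2) (Fin 2) (Enveloping ε)) z =
      Matrix.scalar (Fin 2) (z : Enveloping ε) := by
  rw [Algebra.algebraMap_eq_smul_one, ← map_one (Matrix.scalar (Fin 2)),
    ← scalar_algebraMap_smul]
  simp [Subalgebra.smul_def]

theorem scalar_injective : Function.Injective
    (Matrix.scalar (Fin 2) : Enveloping ε →+* Matrix (Fin 2) (Fin 2) (Enveloping ε)) :=
  fun u v h => by simpa [Matrix.scalar_apply] using congrFun (congrFun h 0) 0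

theorem algebraMap_center_injective : Function.Injective
    (algebraMap (Subalgebra.center K (Enveloping ε))
      (Matrix (Fin 2) (Fin 2) (Enveloping ε))) := fun z z' h => by
  rw [algebraMap_center_eq, algebraMap_center_eq] at h
  exact Subtype.ext (scalar_injective h)

/-- The point is that `P` does not depend on `t`, so that the values before and after deframing can
be compared. -/
theorem exists_polynomial_wordValue (hε : ε = 1 ∨ ε = -1) {n : ℕ} (d : GaussWord n) :
    ∃ P : MvPolynomial (Fin 2) K, ∀ t : Subalgebra.center K (Enveloping ε),
      wordValue (centerParam ε) t (twistedGen ε) d.letters =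
        algebraMap _ _ (MvPolynomial.aeval ![t, yElem ε] P) := by
  obtain ⟨P, hP⟩ := (twistedGen_isTwistedRep ε hε).exists_polynomial (K := K) rfl Finset.univ
    d.letters fun i => Or.inr (d.gauss i)
  exact ⟨P, fun t => by simpa [wordValue] using hP t⟩

/-- Centrality comes from polynomiality: the weight is a polynomial in the central elements `H²` and
`y`. -/
theorem wordWeight_mem_center (hε : ε = 1 ∨ ε = -1) {n : ℕ} (d : GaussWord n) :
    wordWeight ε d ∈ Subalgebra.center K (Enveloping ε) := by
  obtain ⟨P, hP⟩ := exists_polynomial_wordValue hε d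
  have := scalar_wordWeight ε d
  rw [hP, algebraMap_center_eq] at this
  rw [scalar_injective this]
  exact Subtype.prop _

/-- The weight of a word, as an element of the center. -/
def centralWeight (hε : ε = 1 ∨ ε = -1) {n : ℕ} (d : GaussWord n) :
    Subalgebra.center K (Enveloping ε) := ⟨wordWeight ε d, wordWeight_mem_center hε d⟩

theorem algebraMap_centralWeight (hε : ε = 1 ∨ ε = -1) {n : ℕ} (d : GaussWord n) :
    algebraMap _ _ (centralWeight hε d) =
      wordValue (centerParam ε) (centralGen ε ^ 2) (twistedGen ε) d.letters := by
  rw [algebraMap_center_eq, ← scalar_wordWeight]; rfl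

/-- The weight of a chord diagram. -/
def diagramWeight (hε : ε = 1 ∨ ε = -1) {n : ℕ} :
    ChordDiagram n → Subalgebra.center K (Enveloping ε) :=
  Quotient.lift (centralWeight hε) (by
    rintro d d' ⟨σ, h⟩
    apply algebraMap_center_injective
    rw [algebraMap_centralWeight, algebraMap_centralWeight, ← wordValue_map_perm _ _ _ σ]
    refine (twistedGen_isTwistedRep ε hε).wordValue_isRotated _ (fun i => Or.inr ?_) h
    obtain ⟨j, rfl⟩ := σ.surjective i
    rw [List.count_map_of_injective _ _ σ.injective, d.gauss])

theorem diagramWeight_fourTerm (hε : ε = 1 ∨ ε = -1) (n : ℕ) :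
    Submodule.span K (fourTerm K n) ≤
      LinearMap.ker (Finsupp.linearCombination K (diagramWeight hε (n := n))) := by
  rw [Submodule.span_le]
  rintro _ ⟨a, b, U, V, W, h₁, h₂, h₃, h₄, rfl⟩
  have key : ∀ (l : List (Fin n)) (h : IsGauss l),
      Finsupp.linearCombination K (diagramWeight hε (n := n)) (vec K l h) =
        centralWeight hε ⟨l, h⟩ := by
    intro l h
    rw [vec, Finsupp.linearCombination_single, one_smul]
    rfl
  simp only [SetLike.mem_coe, LinearMap.mem_ker, map_sub, map_add, key]
  apply algebraMap_center_injective
  simp only [map_sub, map_add, map_zero, algebraMap_centralWeight]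
  exact (twistedGen_isTwistedRep ε hε).wordValue_fourTerm _ a b U V W h₁

/-- The universal weight system for framed knots. -/
def framedWeight (hε : ε = 1 ∨ ε = -1) (n : ℕ) :
    FramedSpace K n →ₗ[K] Subalgebra.center K (Enveloping ε) :=
  Submodule.liftQ _ _ (diagramWeight_fourTerm hε n)

theorem framedWeight_cls (hε : ε = 1 ∨ ε = -1) {n : ℕ} (d : GaussWord n) :
    framedWeight hε n (cls K d) = centralWeight hε d := by
  rw [framedWeight, cls, Submodule.liftQ_apply, Finsupp.linearCombination_single, one_smul]
  rfl

theorem framedWeight_thetaMap (hε : ε = 1 ∨ ε = -1) {n : ℕ} (D : FramedSpace K n) :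
    framedWeight hε (n + 1) (thetaMap K n D) = casimir ε * framedWeight hε n D := by
  have : (framedWeight hε (n + 1)).comp (thetaMap K n) =
      (LinearMap.mulLeft K (casimir ε)).comp (framedWeight hε n) := by
    refine framedSpace_ext fun d => algebraMap_center_injective ?_
    simp only [LinearMap.comp_apply, thetaMap_cls, framedWeight_cls, LinearMap.mulLeft_apply,
      map_mul, algebraMap_centralWeight]
    rw [casimir_eq, ← Algebra.smul_def]
    exact (twistedGen_isTwistedRep ε hε).wordValue_addIsolated _ _
  exact LinearMap.congr_fun this D

theorem framedWeight_thetaPowSPow (hε : ε = 1 ∨ ε = -1) (k : ℕ) : ∀ {n : ℕ} (d : GaussWord n),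
    algebraMap _ _ (framedWeight hε n (thetaPowSPow K k n (cls K d))) =
      k.factorial • casimir ε ^ k • deletedValue (centerParam ε) (centralGen ε ^ 2)
        (twistedGen ε) k d.letters := by
  have hX := (twistedGen_isTwistedRep ε hε).zero
  induction k with
  | zero =>
    intro n d
    rw [thetaPowSPow, LinearMap.id_apply, framedWeight_cls, algebraMap_centralWeight]
    simp [deletedValue_zero]
  | succ k ih =>
    intro n d
    cases n with
    | zero => simp [thetaPowSPow, deletedValue, missing_zero_zero]
    | succ n =>
      have hs := sum_deletedValue (centerParam ε) (centralGen ε ^ 2) hX k d.letters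
      rw [thetaPowSPow, LinearMap.comp_apply, LinearMap.comp_apply, framedWeight_thetaMap,
        sMap_cls, map_sum, map_sum, map_mul, map_sum, Nat.factorial_succ, mul_comm, mul_smul,
        smul_comm (k + 1), ← hs, Finset.smul_sum, Finset.smul_sum, Finset.mul_sum]
      refine Finset.sum_congr rfl fun a _ => ?_
      rw [ih, ← Algebra.smul_def, smul_comm _ k.factorial, smul_smul, pow_succ' (casimir ε)]
      rfl

/-- After the factorials cancel, each deleted chord carries `-c`, which shifts the central weight
from `H²` to `H² - c = -y`. -/
theorem framedWeight_deframe [CharZero K] (hε : ε = 1 ∨ ε = -1) {n : ℕ} (d : GaussWord n) :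
    algebraMap _ _ (framedWeight hε n (deframe K n (cls K d))) =
      wordValue (centerParam ε) (-yElem ε) (twistedGen ε) d.letters := by
  have hy : -yElem ε = centralGen ε ^ 2 + -casimir ε := by
    rw [casimir_eq, neg_add, add_neg_cancel_left]
  rw [hy, ← sum_pow_smul_deletedValue, deframe, LinearMap.sum_apply, map_sum, map_sum]
  refine Finset.sum_congr rfl fun k _ => ?_
  have hk : (k.factorial : K) ≠ 0 := by exact_mod_cast k.factorial_ne_zero
  rw [LinearMap.smul_apply, map_smul, Algebra.algebraMap_eq_smul_one, smul_assoc,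
    ← Algebra.algebraMap_eq_smul_one, framedWeight_thetaPowSPow, ← Nat.cast_smul_eq_nsmul K,
    smul_smul, div_mul_cancel₀ _ hk,
    ← algebraMap_smul (Subalgebra.center K (Enveloping ε)) ((-1 : K) ^ k), map_pow, map_neg,
    map_one, ← mul_smul]
  exact congrArg (· • _) (neg_pow (casimir ε) k).symm

theorem framedWeight_deframe_relations [CharZero K] (hε : ε = 1 ∨ ε = -1) (n : ℕ) :
    Submodule.span K (fourTerm K n ∪ oneTerm K n) ≤
      LinearMap.ker ((framedWeight hε n ∘ₗ deframe K n) ∘ₗ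
        (Submodule.span K (fourTerm K n)).mkQ) := by
  rw [Submodule.span_le]
  rintro x (hx | ⟨a, U, h, rfl⟩)
  · rw [SetLike.mem_coe, LinearMap.mem_ker, LinearMap.comp_apply, Submodule.mkQ_apply,
      (Submodule.Quotient.mk_eq_zero _).2 (Submodule.subset_span hx), map_zero]
  · rw [SetLike.mem_coe, LinearMap.mem_ker]
    apply algebraMap_center_injective
    rw [map_zero]
    refine (framedWeight_deframe hε ⟨_, h⟩).trans ?_
    exact (twistedGen_isTwistedRep ε hε).wordValue_isolated a U h

/-- The universal weight system for unframed knots. -/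
def unframedWeight [CharZero K] (hε : ε = 1 ∨ ε = -1) (n : ℕ) :
    UnframedSpace K n →ₗ[K] Subalgebra.center K (Enveloping ε) :=
  Submodule.liftQ _ _ (framedWeight_deframe_relations hε n)

theorem unframedWeight_forgetFraming [CharZero K] (hε : ε = 1 ∨ ε = -1) {n : ℕ}
    (D : FramedSpace K n) :
    unframedWeight hε n (forgetFraming K n D) = framedWeight hε n (deframe K n D) := by
  obtain ⟨x, rfl⟩ := Submodule.mkQ_surjective _ D
  rfl

theorem exists_polynomial_weights [CharZero K] (hε : ε = 1 ∨ ε = -1) {n : ℕ}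
    (D : FramedSpace K n) : ∃ P : MvPolynomial (Fin 2) K,
      framedWeight hε n D = MvPolynomial.aeval ![casimir ε, yElem ε] P ∧
      framedWeight hε n (deframe K n D) = MvPolynomial.aeval ![0, yElem ε] P := by
  obtain ⟨x, rfl⟩ := Submodule.mkQ_surjective _ D
  induction x using Finsupp.induction_linear with
  | zero => exact ⟨0, by simp⟩
  | add x x' hx hx' =>
    obtain ⟨P, h₁, h₂⟩ := hx
    obtain ⟨P', h₁', h₂'⟩ := hx'
    exact ⟨P + P', by simp only [map_add, h₁, h₁'], by simp only [map_add, h₂, h₂']⟩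
  | single D r =>
    induction D using Quotient.inductionOn with
    | _ d =>
      have hd : (Submodule.span K (fourTerm K n)).mkQ (Finsupp.single (Quotient.mk _ d) r) =
          r • cls K d := by
        rw [cls, ← Submodule.mkQ_apply, ← map_smul, Finsupp.smul_single, smul_eq_mul, mul_one]
        rfl
      rw [hd]
      obtain ⟨P, hP⟩ := exists_polynomial_wordValue hε d
      have h₁ : framedWeight hε n (cls K d) =
          MvPolynomial.aeval ![casimir ε - yElem ε, yElem ε] P := by
        apply algebraMap_center_injective
        rw [framedWeight_cls, algebraMap_centralWeight, hP, casimir_eq, add_sub_cancel_right]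
      have h₂ : framedWeight hε n (deframe K n (cls K d)) =
          MvPolynomial.aeval ![-yElem ε, yElem ε] P := by
        apply algebraMap_center_injective
        rw [framedWeight_deframe, hP]
      have hsub : ∀ u v : Subalgebra.center K (Enveloping ε), MvPolynomial.aeval ![u, v]
          (MvPolynomial.aeval ![(MvPolynomial.X 0 - MvPolynomial.X 1 : MvPolynomial (Fin 2) K),
            MvPolynomial.X 1] P) = MvPolynomial.aeval ![u - v, v] P := by
        intro u v
        rw [← AlgHom.comp_apply, MvPolynomial.comp_aeval]
        congr 2
        funext i
        fin_cases i <;> simp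
      -- Put `t = c - y` in `P`: the actual `c` gives `t = H²`, and `c = 0` gives `t = -y`.
      refine ⟨r • MvPolynomial.aeval ![(MvPolynomial.X 0 - MvPolynomial.X 1 :
        MvPolynomial (Fin 2) K), MvPolynomial.X 1] P, ?_, ?_⟩
      · rw [map_smul, map_smul, h₁, hsub]
      · rw [map_smul, map_smul, map_smul, h₂, hsub, zero_sub]

end WeightSystem

end

end A1Weight

theorem mainTheorem3 (K : Type*) [Field K] [CharZero K] (ε : K) (hε : ε = 1 ∨ ε = -1) (n : ℕ) :
    ∃ (w : A1Weight.FramedSpace K n →ₗ[K] Subalgebra.center K (A1Weight.Enveloping ε))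
      (wbar : A1Weight.UnframedSpace K n →ₗ[K] Subalgebra.center K (A1Weight.Enveloping ε)),
      -- `w` is the universal weight system for framed knots
      (∀ d : A1Weight.GaussWord n,
        (w (A1Weight.cls K d) : A1Weight.Enveloping ε) = A1Weight.wordWeight ε d) ∧
      -- `wbar` is the deframed weight system
      (∀ D : A1Weight.FramedSpace K n,
        wbar (A1Weight.forgetFraming K n D) = w (A1Weight.deframe K n D)) ∧
      -- the values of `w` are polynomials in `c` and `y`, in a unique way
      AlgebraicIndependent K ![A1Weight.casimir ε, A1Weight.yElem ε] ∧
      ∀ D : A1Weight.FramedSpace K n, ∃ P : MvPolynomial (Fin 2) K,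
        w D = MvPolynomial.aeval ![A1Weight.casimir ε, A1Weight.yElem ε] P ∧
        wbar (A1Weight.forgetFraming K n D) =
          MvPolynomial.aeval ![0, A1Weight.yElem ε] P := by
  refine ⟨A1Weight.framedWeight hε n, A1Weight.unframedWeight hε n, fun d => ?_,
    A1Weight.unframedWeight_forgetFraming hε, A1Weight.algebraicIndependent_casimir ?_,
    fun D => ?_⟩
  · rw [A1Weight.framedWeight_cls]; rfl
  · rcases hε with rfl | rfl <;> simp
  · rw [A1Weight.unframedWeight_forgetFraming]
    exact A1Weight.exists_polynomial_weights hε D
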